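/- **Theorem 1.3 (Douglas model for Andô dilation).** All Hilbert spaces are complex and subspaces are closed. For a Hilbert space $\mathcal F$, $H^2(\mathcal F)$ is the Hardy space of $\mathcal F$-valued analytic functions on the unit disk with norm-square summable Taylor coefficients, and $M_\varphi$ is multiplication by $\varphi$. For a projection $P'$ put $P'^\perp = I-P'$. A subspace is co-invariant under an operator if it is invariant under its adjoint. Let $T_1,T_2,T$ be contractions on a Hilbert space $\mathcal H$. Let $D_{T^*}=(I-TT^*)^{1/2}$ and $\mathcal D_{T^*}=\overline{\mathrm{Ran}}\,D_{T^*}$; let $Q\ge 0$ be the operator with $Q^2=\text{SOT-}\lim_n T^nT^{*n}$; let $X^*$ be the isometry of $\overline{\mathrm{Ran}}\,Q$ with $X^*Q=QT^*$, let $W^*$ on $\mathcal R\supseteq\overline{\mathrm{Ran}}\,Q$ be the minimal unitary extension of $X^*$, and let $V_D=M_z\oplus W$ on $H^2(\mathcal D_{T^*})\oplus\mathcal R$. Then the following are equivalent: * **(P)** $T_1T_2=T_2T_1$ and $T=T_1T_2$. * **(A′)** There are Hilbert spaces $\mathcal F_*$ and $\mathcal R_0$, commuting unitaries $W_1,W_2$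 on $\mathcal R_0$, a projection $P'$ and a unitary $U'$ on $\mathcal F_*$ such that $$(V_1^D,V_2^D)=\left(M_{U'^*P'^\perp+zU'^*P'}\oplus W_1,\; M_{P'U'+zP'^\perp U'}\oplus W_2\right)$$ is a commuting pair of isometries on $H^2(\mathcal F_*)\oplus\mathcal R_0$, and a subspace $\mathcal M$ jointly co-invariant under $(V_1^D,V_2^D)$ such that $(T_1,T_2,T)$ is unitarily equivalent to $P_{\mathcal M}(V_1^D,V_2^D,V_1^DV_2^D)|_{\mathcal M}$. * **(D)** There are contractions $D_1,D_2$ on $H^2(\mathcal D_{T^*})\oplus\mathcal R$ and a subspace $\mathcal M'$ jointly co-invariant under $(D_1,D_2,V_D)$ such that $(T_1,T_2,T)$ is unitarily equivalent to $P_{\mathcal M'}(D_1,D_2,V_D)|_{\mathcal M'}$ and $$P_{\mathcal M'}V_D|_{\mathcal M'}=P_{\mathcal M'}D_1D_2|_{\mathcal M'}=P_{\mathcal M'}D_2D_1|_{\mathcal M'}.$$ Moreover, if these statements hold, then there are a Hilbert space $\mathcal F_*$, a projection $P'$ and a unitary $U'$ on $\mathcal F_*$, an isometry $\Gamma:\mathcal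 D_{T^*}\to\mathcal F_*$, and commuting unitaries $W_1,W_2$ on $\mathcal R_0=\mathcal R$ with $W_1W_2=W$ such that: * in (A′), with these $\mathcal F_*,P',U',W_1,W_2$, one can take $\mathcal M=\mathrm{Ran}\,\tilde\Pi$, where $\tilde\Pi:\mathcal H\to H^2(\mathcal F_*)\oplus\mathcal R$, $\tilde\Pi h=\sum_{n\ge0}z^n\Gamma D_{T^*}T^{*n}h\oplus Qh$, is an isometry with $(V_1^D,V_2^D,V_1^DV_2^D)^*\tilde\Pi=\tilde\Pi(T_1,T_2,T_1T_2)^*$; * in (D), one can take $(D_1,D_2)=(M_\Phi\oplus W_1,M_\Psi\oplus W_2)$ with $\Phi(z)=G_1^*+zG_2$, $\Psi(z)=G_2^*+zG_1$, where $(G_1,G_2)=(\Gamma^*P'^\perp U'\Gamma,\;\Gamma^*U'^*P'\Gamma)$. -/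

import Mathlib

noncomputable section

namespace AndoDouglas

open Filter Topology ContinuousLinearMap

universe u v w

/-! ### The vector-valued Hardy space and multiplication operators -/

section Hardy

variable {F : Type u} [NormedAddCommGroup F] [InnerProductSpace ℂ F]
variable {G : Type v} [NormedAddCommGroup G] [InnerProductSpace ℂ G]

/-- The Hardy space `H²(F)` of the unit disk: an `F`-valued analytic function with norm-square
summable Taylor coefficients at the origin is represented by the sequence of these coefficients.
Its value at a point of the disk is `hardyEval`. -/
abbrev Hardy (F : Type u) [NormedAddCommGroup F] [InnerProductSpace ℂ F] : Type u :=
  lp (fun _ : ℕ => F) 2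

/-- The value `f(z) = ∑ zⁿ fₙ`, for `z` in the open unit disk. -/
def hardyEval (f : Hardy F) (z : ℂ) : F := ∑' n : ℕ, z ^ n • f n

theorem hardy_summable (f : Hardy F) : Summable fun n => ‖f n‖ ^ 2 := by
  simpa using (lp.memℓp f).summable (by norm_num)

theorem hardy_norm_sq (f : Hardy F) : ‖f‖ ^ 2 = ∑' n, ‖f n‖ ^ 2 := by
  simpa using lp.norm_rpow_eq_tsum (p := 2) (by norm_num) f

theorem hardy_mem {F : Type u} [NormedAddCommGroup F] {f : ℕ → F} (hf : Summable fun n => ‖f n‖ ^ 2) :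
    Memℓp (E := fun _ : ℕ => F) f 2 :=
  memℓp_gen (by simpa using hf)

/-- The element of `H²(F)` with a given square summable coefficient sequence. -/
def hardyMk (f : ℕ → F) (hf : Summable fun n => ‖f n‖ ^ 2) : Hardy F := ⟨f, hardy_mem hf⟩

@[simp] theorem hardyMk_apply (f : ℕ → F) (hf : Summable fun n => ‖f n‖ ^ 2) (n : ℕ) :
    hardyMk f hf n = f n := rfl

theorem hardyMap_summable (A : F →L[ℂ] G) (f : Hardy F) : Summable fun n => ‖A (f n)‖ ^ 2 := by
  refine Summable.of_nonneg_of_le (fun n => by positivity) (fun n => ?_)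
    ((hardy_summable f).mul_left (‖A‖ ^ 2))
  rw [← mul_pow]
  exact pow_le_pow_left₀ (norm_nonneg _) (A.le_opNorm _) 2

/-- The operator `I ⊗ A : H²(F) → H²(G)`, which applies `A` to every coefficient. -/
def hardyMap (A : F →L[ℂ] G) : Hardy F →L[ℂ] Hardy G :=
  LinearMap.mkContinuous
    { toFun := fun f => hardyMk (fun n => A (f n)) (hardyMap_summable A f)
      map_add' := fun f g => by ext n; simp
      map_smul' := fun c f => by ext n; simp } ‖A‖ (fun f => by
    refine le_of_sq_le_sq ?_ (by positivity)
    rw [hardy_norm_sq, mul_pow, hardy_norm_sq, ← tsum_mul_left]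
    refine Summable.tsum_le_tsum (fun n => ?_) (hardyMap_summable A f)
      ((hardy_summable f).mul_left _)
    rw [← mul_pow]
    exact pow_le_pow_left₀ (norm_nonneg _) (A.le_opNorm _) 2)

@[simp] theorem hardyMap_apply (A : F →L[ℂ] G) (f : Hardy F) (n : ℕ) :
    hardyMap A f n = A (f n) := rfl

/-- The coefficients of `z f(z)`. -/
def shiftSeq (f : ℕ → F) : ℕ → F
  | 0 => 0
  | n + 1 => f n

theorem shiftSeq_summable (f : Hardy F) : Summable fun n => ‖shiftSeq (⇑f) n‖ ^ 2 :=
  (summable_nat_add_iff 1).1 (by simpa [shiftSeq] using hardy_summable f)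

/-- The forward shift `M_z` on `H²(F)`. -/
def hardyShift (F : Type u) [NormedAddCommGroup F] [InnerProductSpace ℂ F] :
    Hardy F →L[ℂ] Hardy F :=
  LinearMap.mkContinuous
    { toFun := fun f => hardyMk (shiftSeq (⇑f)) (shiftSeq_summable f)
      map_add' := fun f g => by ext n; cases n <;> simp [shiftSeq]
      map_smul' := fun c f => by ext n; cases n <;> simp [shiftSeq] } 1 (fun f => by
    refine le_of_sq_le_sq ?_ (by positivity)
    rw [one_mul, hardy_norm_sq, hardy_norm_sq]
    refine le_of_eq ?_
    have := (shiftSeq_summable f).tsum_eq_zero_add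
    simpa [shiftSeq] using this)

@[simp] theorem hardyShift_zero (f : Hardy F) : hardyShift F f 0 = 0 := rfl

@[simp] theorem hardyShift_succ (f : Hardy F) (n : ℕ) : hardyShift F f (n + 1) = f n := rfl

/-- The multiplication operator `M_φ` on `H²(F)` with symbol `φ(z) = A + z B`. -/
def mulAffine (A B : F →L[ℂ] F) : Hardy F →L[ℂ] Hardy F :=
  hardyMap A + (hardyShift F).comp (hardyMap B)

theorem hardyEval_summable [CompleteSpace F] (f : Hardy F) {z : ℂ} (hz : ‖z‖ < 1) :
    Summable fun n : ℕ => z ^ n • f n := by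
  refine Summable.of_norm_bounded ((summable_geometric_of_lt_one (norm_nonneg z) hz).mul_right ‖f‖)
    (fun n => ?_)
  rw [norm_smul, norm_pow]
  exact mul_le_mul_of_nonneg_left (lp.norm_apply_le_norm (by norm_num) f n) (by positivity)

/-- `(M_φ f)(z) = φ(z) f(z)` in the unit disk, for `φ(z) = A + z B`. -/
theorem hardyEval_mulAffine [CompleteSpace F] (A B : F →L[ℂ] F) (f : Hardy F) {z : ℂ}
    (hz : ‖z‖ < 1) :
    hardyEval (mulAffine A B f) z = (A + z • B) (hardyEval f z) := by
  have hA : HasSum (fun n : ℕ => z ^ n • (hardyMap A f) n) (A (hardyEval f z)) := by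
    simpa [hardyEval] using A.hasSum (hardyEval_summable f hz).hasSum
  have hB0 : HasSum (fun n : ℕ => z ^ (n + 1) • (hardyShift F (hardyMap B f)) (n + 1))
      (z • B (hardyEval f z)) := by
    have := (B.hasSum (hardyEval_summable f hz).hasSum).const_smul z
    simpa [hardyEval, pow_succ', mul_smul] using this
  have hB : HasSum (fun n : ℕ => z ^ n • (hardyShift F (hardyMap B f)) n)
      (z • B (hardyEval f z)) := by
    have := (hasSum_nat_add_iff (f := fun n : ℕ => z ^ n • (hardyShift F (hardyMap B f)) n) 1).1 hB0
    simpa using this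
  have := (hA.add hB).tsum_eq
  simpa [hardyEval, mulAffine, smul_add] using this

end Hardy

/-! ### Hilbert space direct sums, compressions -/

section Compression

variable {H : Type u} [NormedAddCommGroup H] [InnerProductSpace ℂ H]
variable {K : Type v} [NormedAddCommGroup K] [InnerProductSpace ℂ K]

/-- The operator `A ⊕ B` on the Hilbert space direct sum `H ⊕ K`. -/
def directSum (A : H →L[ℂ] H) (B : K →L[ℂ] K) :
    WithLp 2 (H × K) →L[ℂ] WithLp 2 (H × K) :=
  ((WithLp.prodContinuousLinearEquiv 2 ℂ H K).symm : (H × K) →L[ℂ] WithLp 2 (H × K)).comp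
    ((A.prodMap B).comp
      (WithLp.prodContinuousLinearEquiv 2 ℂ H K : WithLp 2 (H × K) →L[ℂ] (H × K)))

/-- `P_M V|_M`, an operator on the closed subspace `M`. -/
def compression (M : Submodule ℂ K) [CompleteSpace M] (V : K →L[ℂ] K) : M →L[ℂ] M :=
  M.orthogonalProjectionOnto.comp (V.comp M.subtypeL)

/-- `M` is co-invariant under `V`: it is invariant under `V*`. -/
def Coinvariant [CompleteSpace K] (M : Submodule ℂ K) (V : K →L[ℂ] K) : Prop :=
  ∀ x ∈ M, adjoint V x ∈ M

/-- The triples `(A₁, A₂, A₃)` on `H` and `(B₁, B₂, B₃)` on `K` are unitarily equivalent, by one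
unitary operator for all three entries. -/
def UnitarilyEquivalent (A₁ A₂ A₃ : H →L[ℂ] H) (B₁ B₂ B₃ : K →L[ℂ] K) : Prop :=
  ∃ τ : H ≃ₗᵢ[ℂ] K, ∀ h, τ (A₁ h) = B₁ (τ h) ∧ τ (A₂ h) = B₂ (τ h) ∧ τ (A₃ h) = B₃ (τ h)

end Compression

/-! ### Defect spaces and the space `R` of the Douglas dilation -/

section Douglas

variable {H : Type u} [NormedAddCommGroup H] [InnerProductSpace ℂ H] [CompleteSpace H]

/-- The defect operator `D_T = (I - T*T)^{1/2}`. -/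
def defect (T : H →L[ℂ] H) : H →L[ℂ] H := CFC.sqrt (1 - adjoint T * T)

/-- The defect space, the closure of the range of `D_T`. -/
abbrev defectSpace (T : H →L[ℂ] H) : Submodule ℂ H :=
  (LinearMap.range (defect T).toLinearMap).topologicalClosure

/-- `D_T h`, as an element of the defect space. -/
def defectVec (T : H →L[ℂ] H) (h : H) : defectSpace T :=
  ⟨defect T h, Submodule.le_topologicalClosure _ ⟨h, rfl⟩⟩

theorem opMul_apply {H : Type u} [NormedAddCommGroup H] [InnerProductSpace ℂ H]
    (A B : H →L[ℂ] H) (x : H) : (A * B) x = A (B x) := rfl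

theorem norm_pow_apply_le {H : Type u} [NormedAddCommGroup H] [InnerProductSpace ℂ H]
    (S : H →L[ℂ] H) (hS : ‖S‖ ≤ 1) (n : ℕ) (h : H) :
    ‖(S ^ n) h‖ ≤ ‖h‖ := by
  induction n with
  | zero => simp
  | succ n ih =>
    rw [pow_succ', opMul_apply]
    exact ((S.le_of_opNorm_le hS _).trans (by simpa using ih))

theorem inner_pow_adjoint (T : H →L[ℂ] H) (n : ℕ) (x y : H) :
    inner ℂ ((T ^ n) x) y = inner ℂ x ((adjoint T ^ n) y) := by
  rw [← star_eq_adjoint, ← star_pow, star_eq_adjoint, adjoint_inner_right]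

theorem norm_sub_sq_le (T : H →L[ℂ] H) (hT : ‖T‖ ≤ 1) (m k : ℕ) (h : H) :
    ‖(T ^ m) ((adjoint T ^ m) h) - (T ^ (m + k)) ((adjoint T ^ (m + k)) h)‖ ^ 2 ≤
      ‖(adjoint T ^ m) h‖ ^ 2 - ‖(adjoint T ^ (m + k)) h‖ ^ 2 := by
  set y := (adjoint T ^ m) h with hy
  have h1 : (adjoint T ^ (m + k)) h = (adjoint T ^ k) y := by
    rw [add_comm, pow_add, opMul_apply]
  have h2 : (T ^ m) y - (T ^ (m + k)) ((adjoint T ^ (m + k)) h)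
      = (T ^ m) (y - (T ^ k) ((adjoint T ^ k) y)) := by
    rw [h1, pow_add, opMul_apply, map_sub]
  rw [h2, h1]
  have h3 : ‖(T ^ m) (y - (T ^ k) ((adjoint T ^ k) y))‖ ^ 2 ≤
      ‖y - (T ^ k) ((adjoint T ^ k) y)‖ ^ 2 :=
    pow_le_pow_left₀ (norm_nonneg _) (norm_pow_apply_le T hT m _) 2
  have h4 : ‖(T ^ k) ((adjoint T ^ k) y)‖ ^ 2 ≤ ‖(adjoint T ^ k) y‖ ^ 2 :=
    pow_le_pow_left₀ (norm_nonneg _) (norm_pow_apply_le T hT k _) 2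
  have h5 : RCLike.re (inner ℂ y ((T ^ k) ((adjoint T ^ k) y))) = ‖(adjoint T ^ k) y‖ ^ 2 := by
    rw [← inner_re_symm, inner_pow_adjoint, inner_self_eq_norm_sq]
  have h6 := norm_sub_sq (𝕜 := ℂ) y ((T ^ k) ((adjoint T ^ k) y))
  rw [h5] at h6
  linarith

theorem exists_strong_limit (T : H →L[ℂ] H) (hT : ‖T‖ ≤ 1) :
    ∃ A : H →L[ℂ] H, 0 ≤ A ∧
      ∀ h, Tendsto (fun n : ℕ => (T ^ n) ((adjoint T ^ n) h)) atTop (𝓝 (A h)) := by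
  have hS : ‖adjoint T‖ ≤ 1 := by simpa using hT
  have hcau : ∀ h, CauchySeq fun n : ℕ => (T ^ n) ((adjoint T ^ n) h) := by
    intro h
    have hanti : Antitone fun n : ℕ => ‖(adjoint T ^ n) h‖ ^ 2 := by
      refine antitone_nat_of_succ_le fun n => ?_
      refine pow_le_pow_left₀ (norm_nonneg _) ?_ 2
      rw [pow_succ', opMul_apply]
      simpa using (adjoint T).le_of_opNorm_le hS ((adjoint T ^ n) h)
    have hconv := tendsto_atTop_ciInf hanti ⟨0, by rintro _ ⟨n, rfl⟩; positivity⟩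
    have hc := hconv.cauchySeq
    rw [Metric.cauchySeq_iff'] at hc ⊢
    intro ε hε
    obtain ⟨N, hN⟩ := hc (ε ^ 2) (by positivity)
    refine ⟨N, fun n hn => ?_⟩
    obtain ⟨k, rfl⟩ := Nat.exists_eq_add_of_le hn
    have h1 := norm_sub_sq_le T hT N k h
    have h2 := hN (N + k) hn
    rw [dist_comm, Real.dist_eq] at h2
    rw [dist_comm, dist_eq_norm]
    exact lt_of_pow_lt_pow_left₀ 2 hε.le (h1.trans_lt ((le_abs_self _).trans_lt h2))
  choose a ha using fun h => cauchySeq_tendsto_of_complete (hcau h)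
  let A : H →L[ℂ] H := LinearMap.mkContinuous
    { toFun := a
      map_add' := fun x y => tendsto_nhds_unique (ha (x + y)) (by
        simpa using (ha x).add (ha y))
      map_smul' := fun c x => tendsto_nhds_unique (ha (c • x)) (by
        simpa using (ha x).const_smul c) } 1 (fun h => by
    refine le_of_tendsto (ha h).norm (Eventually.of_forall fun n => ?_)
    rw [one_mul]
    exact (norm_pow_apply_le T hT n _).trans (norm_pow_apply_le _ hS n h))
  refine ⟨A, ?_, ha⟩
  rw [nonneg_iff_isPositive]
  refine ⟨fun x y => ?_, fun x => ?_⟩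
  · refine tendsto_nhds_unique ((ha x).inner tendsto_const_nhds) ?_
    refine (Tendsto.inner (𝕜 := ℂ) (tendsto_const_nhds (x := x)) (ha y)).congr fun n => ?_
    rw [inner_pow_adjoint, ← inner_conj_symm, inner_pow_adjoint, inner_conj_symm]
  · have h0 : Tendsto (fun n : ℕ => RCLike.re (inner ℂ ((T ^ n) ((adjoint T ^ n) x)) x)) atTop
        (𝓝 (RCLike.re (inner ℂ (A x) x))) :=
      (RCLike.continuous_re.tendsto _).comp ((ha x).inner tendsto_const_nhds)
    refine ge_of_tendsto h0 (Eventually.of_forall fun n => ?_)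
    rw [inner_pow_adjoint, inner_self_eq_norm_sq]
    positivity

theorem exists_Q (T : H →L[ℂ] H) (hT : ‖T‖ ≤ 1) :
    ∃ Q : H →L[ℂ] H, Q.IsPositive ∧
      ∀ h, Tendsto (fun n : ℕ => (T ^ n) ((adjoint T ^ n) h)) atTop (𝓝 (Q (Q h))) := by
  obtain ⟨A, hA, hlim⟩ := exists_strong_limit T hT
  refine ⟨CFC.sqrt A, (nonneg_iff_isPositive _).1 (CFC.sqrt_nonneg A), fun h => ?_⟩
  rw [← opMul_apply, CFC.sqrt_mul_sqrt_self A hA]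
  exact hlim h

/-- The positive operator `Q` such that `Q²` is the strong limit of `Tⁿ T*ⁿ`. -/
def opQ (T : H →L[ℂ] H) (hT : ‖T‖ ≤ 1) : H →L[ℂ] H := Classical.choose (exists_Q T hT)

theorem opQ_isPositive (T : H →L[ℂ] H) (hT : ‖T‖ ≤ 1) : (opQ T hT).IsPositive :=
  (Classical.choose_spec (exists_Q T hT)).1

theorem opQ_tendsto (T : H →L[ℂ] H) (hT : ‖T‖ ≤ 1) (h : H) :
    Tendsto (fun n : ℕ => (T ^ n) ((adjoint T ^ n) h)) atTop (𝓝 (opQ T hT (opQ T hT h))) :=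
  (Classical.choose_spec (exists_Q T hT)).2 h

/-- The closure of the range of `Q`. -/
abbrev ranQ (T : H →L[ℂ] H) (hT : ‖T‖ ≤ 1) : Submodule ℂ H :=
  (LinearMap.range (opQ T hT).toLinearMap).topologicalClosure

/-- `Q`, as an operator into the closure of its range. -/
def opQr (T : H →L[ℂ] H) (hT : ‖T‖ ≤ 1) : H →L[ℂ] ranQ T hT :=
  (opQ T hT).codRestrict (ranQ T hT) fun h => Submodule.le_topologicalClosure _ ⟨h, rfl⟩

@[simp] theorem coe_opQr (T : H →L[ℂ] H) (hT : ‖T‖ ≤ 1) (h : H) :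
    (opQr T hT h : H) = opQ T hT h := rfl

theorem opQr_denseRange (T : H →L[ℂ] H) (hT : ‖T‖ ≤ 1) : DenseRange (opQr T hT) := by
  rw [DenseRange, Subtype.dense_iff]
  intro x hx
  rw [← Set.range_comp]
  exact hx

theorem norm_opQ_adjoint (T : H →L[ℂ] H) (hT : ‖T‖ ≤ 1) (h : H) :
    ‖opQ T hT (adjoint T h)‖ = ‖opQ T hT h‖ := by
  have key : ∀ h, Tendsto (fun n : ℕ => ‖(adjoint T ^ n) h‖ ^ 2) atTop
      (𝓝 (‖opQ T hT h‖ ^ 2)) := by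
    intro h
    have h0 : Tendsto (fun n : ℕ => RCLike.re (inner ℂ ((T ^ n) ((adjoint T ^ n) h)) h)) atTop
        (𝓝 (RCLike.re (inner ℂ (opQ T hT (opQ T hT h)) h))) :=
      (RCLike.continuous_re.tendsto _).comp ((opQ_tendsto T hT h).inner tendsto_const_nhds)
    have h1 : inner ℂ (opQ T hT (opQ T hT h)) h = inner ℂ (opQ T hT h) (opQ T hT h) :=
      (opQ_isPositive T hT).1 _ _
    rw [h1, inner_self_eq_norm_sq] at h0
    refine h0.congr fun n => ?_
    rw [inner_pow_adjoint, inner_self_eq_norm_sq]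
  have h1 := key (adjoint T h)
  have h2 := (key h).comp (tendsto_add_atTop_nat 1)
  have h3 := tendsto_nhds_unique (h1.congr fun n => by
    rw [Function.comp_apply, pow_succ (adjoint T) n, opMul_apply]) h2
  exact (pow_left_inj₀ (norm_nonneg _) (norm_nonneg _) two_ne_zero).1 h3

theorem exists_X (T : H →L[ℂ] H) (hT : ‖T‖ ≤ 1) :
    ∃ X : ranQ T hT →ₗᵢ[ℂ] ranQ T hT, ∀ h, X (opQr T hT h) = opQr T hT (adjoint T h) := by
  let f : H →ₗ[ℂ] ranQ T hT := ((opQr T hT).comp (adjoint T)).toLinearMap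
  let e : H →ₗ[ℂ] ranQ T hT := (opQr T hT).toLinearMap
  have hd : DenseRange e := opQr_denseRange T hT
  have hn : ∀ x, ‖f x‖ = ‖e x‖ := norm_opQ_adjoint T hT
  have heq : ∀ x, f.extendOfNorm e (e x) = f x :=
    LinearMap.extendOfNorm_eq hd ⟨1, fun x => by rw [one_mul, hn]⟩
  refine ⟨⟨(f.extendOfNorm e).toLinearMap, fun x => ?_⟩, heq⟩
  refine hd.induction (P := fun x => ‖f.extendOfNorm e x‖ = ‖x‖) ?_
    (isClosed_eq (by fun_prop) (by fun_prop)) x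
  rintro _ ⟨y, rfl⟩
  rw [heq, hn]

/-- The isometry `X*` of the closure of the range of `Q` with `X* Q = Q T*`. -/
def isoX (T : H →L[ℂ] H) (hT : ‖T‖ ≤ 1) : ranQ T hT →ₗᵢ[ℂ] ranQ T hT :=
  Classical.choose (exists_X T hT)

theorem isoX_opQr (T : H →L[ℂ] H) (hT : ‖T‖ ≤ 1) (h : H) :
    isoX T hT (opQr T hT h) = opQr T hT (adjoint T h) :=
  Classical.choose_spec (exists_X T hT) h

end Douglas

section UnitaryExtension

variable {K : Type u} [NormedAddCommGroup K] [InnerProductSpace ℂ K] [CompleteSpace K]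

/-- The unitary operator `Y` on `R` is a minimal unitary extension of the isometry `V` on `K`,
where `K` is regarded as a subspace of `R` by the isometric embedding `ι`: it extends `V`, and the
subspaces `Yⁿ K`, `n ∈ ℤ`, span a dense subspace of `R`. -/
structure IsMinimalUnitaryExtension (V : K →ₗᵢ[ℂ] K)
    {R : Type v} [NormedAddCommGroup R] [InnerProductSpace ℂ R] [CompleteSpace R]
    (ι : K →ₗᵢ[ℂ] R) (Y : unitary (R →L[ℂ] R)) : Prop where
  extends_isometry : ∀ k, (Y : R →L[ℂ] R) (ι k) = ι (V k)
  minimal : (Submodule.span ℂ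
    {x : R | ∃ (n : ℤ) (k : K), x = ((Y ^ n : unitary (R →L[ℂ] R)) : R →L[ℂ] R) (ι k)}
    ).topologicalClosure = ⊤

theorem unitary_pow_succ_apply (Y : unitary (K →L[ℂ] K)) (n : ℕ) (x : K) :
    ((Y ^ (n + 1) : unitary (K →L[ℂ] K)) : K →L[ℂ] K) x =
      ((Y ^ n : unitary (K →L[ℂ] K)) : K →L[ℂ] K) ((Y : K →L[ℂ] K) x) := by
  rw [pow_succ, Submonoid.coe_mul, opMul_apply]

theorem unitary_zpow_neg_apply (Y : unitary (K →L[ℂ] K)) (n : ℕ) (x : K) :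
    ((Y ^ (-(n : ℤ)) : unitary (K →L[ℂ] K)) : K →L[ℂ] K)
      (((Y ^ n : unitary (K →L[ℂ] K)) : K →L[ℂ] K) x) = x := by
  rw [← opMul_apply, ← Submonoid.coe_mul, zpow_neg, zpow_natCast, inv_mul_cancel]
  simp

/-- The subspace `K ⊖ V K`. -/
abbrev wander (V : K →ₗᵢ[ℂ] K) : Submodule ℂ K := (LinearMap.range V.toLinearMap)ᗮ

/-- The backward shift on coefficient sequences. -/
def hardyTail {F : Type u} [NormedAddCommGroup F] [InnerProductSpace ℂ F] (d : Hardy F) :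
    Hardy F :=
  hardyMk (fun n => d (n + 1)) ((summable_nat_add_iff 1).2 (hardy_summable d))

theorem exists_unitary_on_sum (V : K →ₗᵢ[ℂ] K) :
    ∃ (ι : K →ₗᵢ[ℂ] WithLp 2 (K × Hardy (wander V)))
      (Y : unitary (WithLp 2 (K × Hardy (wander V)) →L[ℂ] WithLp 2 (K × Hardy (wander V)))),
      (∀ k, ι k = WithLp.toLp 2 (k, 0)) ∧
      ∀ x, (Y : WithLp 2 (K × Hardy (wander V)) →L[ℂ] WithLp 2 (K × Hardy (wander V))) x =
        WithLp.toLp 2 (V x.fst + (x.snd 0 : K), hardyTail x.snd) := by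
  have hVN : ∀ (k : K) (b : (wander V)), inner ℂ (V k) (b : K) = 0 := fun k b => b.2 (V k) ⟨k, rfl⟩
  have hnorm : ∀ d : Hardy (wander V), ‖d‖ ^ 2 = ‖d 0‖ ^ 2 + ‖hardyTail d‖ ^ 2 := by
    intro d
    rw [hardy_norm_sq, hardy_norm_sq, (hardy_summable d).tsum_eq_zero_add]
    rfl
  let f : WithLp 2 (K × Hardy (wander V)) →ₗᵢ[ℂ] WithLp 2 (K × Hardy (wander V)) :=
    { toFun := fun x => WithLp.toLp 2 (V x.fst + (x.snd 0 : K), hardyTail x.snd)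
      map_add' := fun x y => by
        apply WithLp.ofLp_injective
        refine Prod.ext ?_ ?_
        · simp
          abel
        · ext n
          simp [hardyTail]
      map_smul' := fun c x => by
        apply WithLp.ofLp_injective
        refine Prod.ext ?_ ?_
        · simp
        · ext n
          simp [hardyTail]
      norm_map' := fun x => by
        refine (pow_left_inj₀ (norm_nonneg _) (norm_nonneg _) two_ne_zero).1 ?_
        change ‖(WithLp.toLp 2 (V x.fst + (x.snd 0 : K), hardyTail x.snd) : WithLp 2 (K × Hardy (wander V)))‖ ^ 2
          = ‖x‖ ^ 2
        rw [WithLp.prod_norm_sq_eq_of_L2, WithLp.prod_norm_sq_eq_of_L2 x, hnorm x.snd]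
        have := norm_add_sq_eq_norm_sq_add_norm_sq_of_inner_eq_zero _ _ (hVN x.fst (x.snd 0))
        simp only [V.norm_map] at this
        change ‖V x.fst + (x.snd 0 : K)‖ ^ 2 + ‖hardyTail x.snd‖ ^ 2 = _
        rw [sq ‖V x.fst + (x.snd 0 : K)‖, this]
        simp only [Submodule.coe_norm]
        ring }
  have hsurj : Function.Surjective f := by
    intro y
    let V' : K →L[ℂ] K := V.toContinuousLinearMap
    let a : K := adjoint V' y.fst
    have hb : y.fst - V a ∈ (wander V) := by
      rintro _ ⟨k, rfl⟩
      have h1 : inner ℂ (V k) (V a) = inner ℂ k a := V.inner_map_map k a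
      have h2 : inner ℂ k a = inner ℂ (V k) y.fst := adjoint_inner_right V' k y.fst
      change inner ℂ (V k) (y.fst - V a) = 0
      rw [inner_sub_right, h1, h2, sub_self]
    let g : ℕ → (wander V) := fun n => Nat.casesOn n ⟨y.fst - V a, hb⟩ fun m => y.snd m
    have hg : Summable fun n => ‖g n‖ ^ 2 :=
      (summable_nat_add_iff 1).1 (hardy_summable y.snd)
    refine ⟨WithLp.toLp 2 (a, hardyMk g hg), ?_⟩
    apply WithLp.ofLp_injective
    refine Prod.ext ?_ ?_
    · change V a + (y.fst - V a) = y.fst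
      abel
    · ext n
      rfl
  let e : WithLp 2 (K × Hardy (wander V)) ≃ₗᵢ[ℂ] WithLp 2 (K × Hardy (wander V)) :=
    LinearIsometryEquiv.ofSurjective f hsurj
  let ι : K →ₗᵢ[ℂ] WithLp 2 (K × Hardy (wander V)) :=
    { toFun := fun k => WithLp.toLp 2 (k, 0)
      map_add' := fun x y => by
        apply WithLp.ofLp_injective
        simp
      map_smul' := fun c x => by
        apply WithLp.ofLp_injective
        simp
      norm_map' := fun x => by
        change ‖(WithLp.toLp 2 (x, 0) : WithLp 2 (K × Hardy (wander V)))‖ = ‖x‖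
        simp }
  let Y : unitary (WithLp 2 (K × Hardy (wander V)) →L[ℂ] WithLp 2 (K × Hardy (wander V))) :=
    Unitary.linearIsometryEquiv.symm e
  have hY : ∀ x, (Y : WithLp 2 (K × Hardy (wander V)) →L[ℂ] WithLp 2 (K × Hardy (wander V))) x = f x := fun x => rfl
  exact ⟨ι, Y, fun _ => rfl, hY⟩

theorem exists_minimalUnitaryExtension (V : K →ₗᵢ[ℂ] K) :
    ∃ (R : Type u) (_ : NormedAddCommGroup R) (_ : InnerProductSpace ℂ R) (_ : CompleteSpace R)
      (ι : K →ₗᵢ[ℂ] R) (Y : unitary (R →L[ℂ] R)), IsMinimalUnitaryExtension V ι Y := by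
  obtain ⟨ι, Y, hι0, hY⟩ := exists_unitary_on_sum V
  refine ⟨WithLp 2 (K × Hardy (wander V)), inferInstance, inferInstance, inferInstance, ι, Y, ?_, ?_⟩
  · intro k
    rw [hY, hι0, hι0]
    apply WithLp.ofLp_injective
    refine Prod.ext ?_ ?_
    · change V k + ((0 : wander V) : K) = V k
      simp
    · ext n
      rfl
  · set S := (Submodule.span ℂ {x | ∃ (n : ℤ) (k : K),
      x = ((Y ^ n : unitary _) : WithLp 2 (K × Hardy (wander V)) →L[ℂ] WithLp 2 (K × Hardy (wander V))) (ι k)}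
      ).topologicalClosure with hS
    have hmem : ∀ (n : ℤ) (k : K),
        ((Y ^ n : unitary _) : WithLp 2 (K × Hardy (wander V)) →L[ℂ] WithLp 2 (K × Hardy (wander V))) (ι k) ∈ S :=
      fun n k => Submodule.le_topologicalClosure _ (Submodule.subset_span ⟨n, k, rfl⟩)
    have hι : ∀ k, ι k ∈ S := fun k => by simpa using hmem 0 k
    have hpow : ∀ (n : ℕ) (b : wander V),
        ((Y ^ (n + 1) : unitary _) : WithLp 2 (K × Hardy (wander V)) →L[ℂ] WithLp 2 (K × Hardy (wander V)))
          (WithLp.toLp 2 (0, lp.single 2 n b)) = ι b := by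
      intro n b
      induction n with
      | zero =>
        rw [zero_add, pow_one, hY, hι0]
        apply WithLp.ofLp_injective
        refine Prod.ext ?_ ?_
        · change V 0 + ((lp.single 2 0 b : Hardy (wander V)) 0 : K) = b
          rw [map_zero, zero_add, lp.single_apply_self]
        · ext n
          change (((lp.single 2 0 b : Hardy (wander V)) (n + 1) : wander V) : K) = 0
          simp
      | succ n ih =>
        rw [unitary_pow_succ_apply, ← ih]
        refine congrArg _ ?_
        rw [hY]
        apply WithLp.ofLp_injective
        refine Prod.ext ?_ ?_
        · change V 0 + ((lp.single 2 (n + 1) b : Hardy (wander V)) 0 : K) = 0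
          simp
        · ext m
          change (((lp.single 2 (n + 1) b : Hardy (wander V)) (m + 1) : wander V) : K)
            = ((lp.single 2 n b : Hardy (wander V)) m : K)
          simp [lp.single_apply, Pi.single_apply]
    have hsingle : ∀ (n : ℕ) (b : wander V),
        (WithLp.toLp 2 (0, lp.single 2 n b) : WithLp 2 (K × Hardy (wander V))) ∈ S := by
      intro n b
      have h1 := hmem (-((n + 1 : ℕ) : ℤ)) b
      rwa [← hpow n b, unitary_zpow_neg_apply] at h1
    have hsnd : ∀ d : Hardy (wander V), (WithLp.toLp 2 (0, d) : WithLp 2 (K × Hardy (wander V))) ∈ S := by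
      intro d
      let j : Hardy (wander V) →L[ℂ] WithLp 2 (K × Hardy (wander V)) :=
        ((WithLp.prodContinuousLinearEquiv 2 ℂ K (Hardy (wander V))).symm :
          (K × Hardy (wander V)) →L[ℂ] WithLp 2 (K × Hardy (wander V))).comp (ContinuousLinearMap.inr ℂ K (Hardy (wander V)))
      have h1 := j.hasSum (lp.hasSum_single (by norm_num) d)
      exact (Submodule.isClosed_topologicalClosure _).mem_of_tendsto h1
        (Eventually.of_forall fun s => S.sum_mem fun i _ => hsingle i (d i))
    rw [eq_top_iff]
    intro x _
    have hx : x = WithLp.toLp 2 (x.fst, 0) + WithLp.toLp 2 (0, x.snd) := by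
      apply WithLp.ofLp_injective
      refine Prod.ext ?_ ?_
      · change x.fst = x.fst + 0
        simp
      · change x.snd = 0 + x.snd
        simp
    rw [hx, ← hι0]
    exact S.add_mem (hι _) (hsnd _)

end UnitaryExtension

/-! ### The model operators and the statements `(P)`, `(A')`, `(D)` -/

section Models

variable {F : Type u} [NormedAddCommGroup F] [InnerProductSpace ℂ F] [CompleteSpace F]
variable {R : Type v} [NormedAddCommGroup R] [InnerProductSpace ℂ R] [CompleteSpace R]

/-- `V₁ = M_φ ⊕ W₁` on `H²(F) ⊕ R` with `φ(z) = U*P^⊥ + z U*P`. -/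
def andoV₁ (P : F →L[ℂ] F) (U : unitary (F →L[ℂ] F)) (W₁ : unitary (R →L[ℂ] R)) :
    WithLp 2 (Hardy F × R) →L[ℂ] WithLp 2 (Hardy F × R) :=
  directSum (mulAffine (adjoint (U : F →L[ℂ] F) * (1 - P)) (adjoint (U : F →L[ℂ] F) * P))
    (W₁ : R →L[ℂ] R)

/-- `V₂ = M_ψ ⊕ W₂` on `H²(F) ⊕ R` with `ψ(z) = PU + z P^⊥U`. -/
def andoV₂ (P : F →L[ℂ] F) (U : unitary (F →L[ℂ] F)) (W₂ : unitary (R →L[ℂ] R)) :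
    WithLp 2 (Hardy F × R) →L[ℂ] WithLp 2 (Hardy F × R) :=
  directSum (mulAffine (P * (U : F →L[ℂ] F)) ((1 - P) * (U : F →L[ℂ] F))) (W₂ : R →L[ℂ] R)

variable {H : Type w} [NormedAddCommGroup H] [InnerProductSpace ℂ H] [CompleteSpace H]

/-- `T = T₁T₂` is a factorization into commuting operators. -/
def CommutingFactorization (T₁ T₂ T : H →L[ℂ] H) : Prop :=
  Commute T₁ T₂ ∧ T = T₁ * T₂

/-- `(V₁, V₂)` is a commuting pair of isometries, the closed subspace `M` is jointly co-invariant
under it, and `(T₁, T₂, T)` is unitarily equivalent to `P_M (V₁, V₂, V₁V₂)|_M`. -/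
def AndoCompression (T₁ T₂ T : H →L[ℂ] H)
    (V₁ V₂ : WithLp 2 (Hardy F × R) →L[ℂ] WithLp 2 (Hardy F × R))
    (M : Submodule ℂ (WithLp 2 (Hardy F × R))) [CompleteSpace M] : Prop :=
  Isometry V₁ ∧ Isometry V₂ ∧ Commute V₁ V₂ ∧ Coinvariant M V₁ ∧ Coinvariant M V₂ ∧
    UnitarilyEquivalent (K := M) T₁ T₂ T (compression M V₁) (compression M V₂) (compression M (V₁ * V₂))

/-- Statement `(A')`, without its supplement on the choice of the co-invariant subspace. -/
def AndoModel {H : Type u} [NormedAddCommGroup H] [InnerProductSpace ℂ H] [CompleteSpace H]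
    (T₁ T₂ T : H →L[ℂ] H) : Prop :=
  ∃ (F : Type u) (_ : NormedAddCommGroup F) (_ : InnerProductSpace ℂ F) (_ : CompleteSpace F)
    (R : Type u) (_ : NormedAddCommGroup R) (_ : InnerProductSpace ℂ R) (_ : CompleteSpace R)
    (P : F →L[ℂ] F) (U : unitary (F →L[ℂ] F)) (W₁ W₂ : unitary (R →L[ℂ] R)),
    IsStarProjection P ∧ Commute W₁ W₂ ∧
    ∃ (M : Submodule ℂ (WithLp 2 (Hardy F × R))) (_ : CompleteSpace M),
      AndoCompression T₁ T₂ T (andoV₁ P U W₁) (andoV₂ P U W₂) M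

/-- The Douglas isometric dilation `V_D = M_z ⊕ W` on `H²(D_{T*}) ⊕ R`. -/
def douglasV (T : H →L[ℂ] H) (W : unitary (R →L[ℂ] R)) :
    WithLp 2 (Hardy (defectSpace (adjoint T)) × R) →L[ℂ]
      WithLp 2 (Hardy (defectSpace (adjoint T)) × R) :=
  directSum (hardyShift (defectSpace (adjoint T))) (W : R →L[ℂ] R)

/-- The property that statement `(D)` requires of the pair `(D₁, D₂)`. -/
def DouglasCompression (T₁ T₂ T : H →L[ℂ] H) (W : unitary (R →L[ℂ] R))
    (D₁ D₂ : WithLp 2 (Hardy (defectSpace (adjoint T)) × R) →L[ℂ]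
      WithLp 2 (Hardy (defectSpace (adjoint T)) × R)) : Prop :=
  ‖D₁‖ ≤ 1 ∧ ‖D₂‖ ≤ 1 ∧
  ∃ (M : Submodule ℂ (WithLp 2 (Hardy (defectSpace (adjoint T)) × R))) (_ : CompleteSpace M),
    Coinvariant M D₁ ∧ Coinvariant M D₂ ∧ Coinvariant M (douglasV T W) ∧
    UnitarilyEquivalent (K := M) T₁ T₂ T (compression M D₁) (compression M D₂)
      (compression M (douglasV T W)) ∧
    compression M (douglasV T W) = compression M (D₁ * D₂) ∧
    compression M (douglasV T W) = compression M (D₂ * D₁)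

/-- Statement `(D)`, without its supplement on the choice of the contractions `(D₁, D₂)`. -/
def DouglasModel (T₁ T₂ T : H →L[ℂ] H) (W : unitary (R →L[ℂ] R)) : Prop :=
  ∃ D₁ D₂ : WithLp 2 (Hardy (defectSpace (adjoint T)) × R) →L[ℂ]
    WithLp 2 (Hardy (defectSpace (adjoint T)) × R), DouglasCompression T₁ T₂ T W D₁ D₂

/-- `M_Φ ⊕ W₁` on `H²(E) ⊕ R`, with `Φ(z) = G₁* + z G₂`. -/
def douglasD {E : Type u} [NormedAddCommGroup E] [InnerProductSpace ℂ E] [CompleteSpace E]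
    (G₁ G₂ : E →L[ℂ] E) (W₁ : unitary (R →L[ℂ] R)) :
    WithLp 2 (Hardy E × R) →L[ℂ] WithLp 2 (Hardy E × R) :=
  directSum (mulAffine (adjoint G₁) G₂) (W₁ : R →L[ℂ] R)

/-- `Γ* B Γ`, for an isometry `Γ : E → F`. -/
def compressTo {E : Type v} [NormedAddCommGroup E] [InnerProductSpace ℂ E] [CompleteSpace E]
    (Γ : E →ₗᵢ[ℂ] F) (B : F →L[ℂ] F) : E →L[ℂ] E :=
  (adjoint Γ.toContinuousLinearMap).comp (B.comp Γ.toContinuousLinearMap)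

/-- The supplements to `(A')` and `(D)`, with the same data in both. There are a Hilbert space `F`,
a projection `P` and a unitary `U` on `F`, an isometry `Γ : D_{T*} → F` and commuting unitaries
`W₁`, `W₂` on the space `R` of the Douglas dilation with `W₁W₂ = W`, such that
* the map `Π h = (∑ zⁿ Γ D_{T*} T*ⁿ h) ⊕ Q h` is an isometry from `H` into `H²(F) ⊕ R` with
  `(V₁, V₂, V₁V₂)* Π = Π (T₁, T₂, T₁T₂)*`, and its range serves as the subspace `M` of `(A')`;
* with `G₁ = Γ* P^⊥ U Γ` and `G₂ = Γ* U* P Γ`, the pair `(M_Φ ⊕ W₁, M_Ψ ⊕ W₂)` for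
  `Φ(z) = G₁* + z G₂`, `Ψ(z) = G₂* + z G₁` serves as the pair `(D₁, D₂)` of `(D)`. -/
def ExplicitModels {H : Type u} [NormedAddCommGroup H] [InnerProductSpace ℂ H] [CompleteSpace H]
    (T₁ T₂ T : H →L[ℂ] H) (hT : ‖T‖ ≤ 1)
    (ι : ranQ T hT →ₗᵢ[ℂ] R) (W : unitary (R →L[ℂ] R)) : Prop :=
  ∃ (F : Type u) (_ : NormedAddCommGroup F) (_ : InnerProductSpace ℂ F) (_ : CompleteSpace F)
    (P : F →L[ℂ] F) (U : unitary (F →L[ℂ] F)) (W₁ W₂ : unitary (R →L[ℂ] R))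
    (Γ : defectSpace (adjoint T) →ₗᵢ[ℂ] F),
    IsStarProjection P ∧ Commute W₁ W₂ ∧ W₁ * W₂ = W ∧
    (∃ (Pi : H →ₗᵢ[ℂ] WithLp 2 (Hardy F × R))
        (_ : CompleteSpace (LinearMap.range Pi.toLinearMap)),
      (∀ h, (∀ n, (Pi h).fst n = Γ (defectVec (adjoint T) ((adjoint T ^ n) h))) ∧
        (Pi h).snd = ι (opQr T hT h)) ∧
      (∀ h, adjoint (andoV₁ P U W₁) (Pi h) = Pi (adjoint T₁ h) ∧
        adjoint (andoV₂ P U W₂) (Pi h) = Pi (adjoint T₂ h) ∧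
        adjoint (andoV₁ P U W₁ * andoV₂ P U W₂) (Pi h) = Pi (adjoint (T₁ * T₂) h)) ∧
      AndoCompression T₁ T₂ T (andoV₁ P U W₁) (andoV₂ P U W₂)
        (LinearMap.range Pi.toLinearMap)) ∧
    DouglasCompression T₁ T₂ T W
      (douglasD (compressTo Γ ((1 - P) * (U : F →L[ℂ] F)))
        (compressTo Γ (adjoint (U : F →L[ℂ] F) * P)) W₁)
      (douglasD (compressTo Γ (adjoint (U : F →L[ℂ] F) * P))
        (compressTo Γ ((1 - P) * (U : F →L[ℂ] F))) W₂)

end Models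

end AndoDouglas

end

noncomputable section

namespace AndoDouglas

open Filter Topology ContinuousLinearMap

universe u v w

/-! Both models give back the factorization because compression to a co-invariant subspace is
multiplicative (`compression_mul`). In (A') the product identity and the commutativity of the model
operators pass to the compressions. In (D) the two required identities turn into `T = T₁T₂` and `T =
T₂T₁`.

Conversely, put `S₁ = T₁*`, `S₂ = T₂*`, `S = T*`. Since `S = S₁S₂ = S₂S₁`, telescoping gives `‖D_S
x‖² = ‖D_{S₁}S₂x‖² + ‖D_{S₂}x‖² = ‖D_{S₁}x‖² + ‖D_{S₂}S₁x‖²`. Hence `Γ : D_S x ↦ (D_{S₁}S₂x,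
D_{S₂}x)` is isometric, and a unitary `U` on a larger space sends this pair to `(D_{S₁}x,
D_{S₂}S₁x)`. With `P` the projection to the first coordinate, `exists_andoTuple` yields two
identities. They say exactly that the adjoints of the multiplication operators act on the
coefficients `Γ D_S Sⁿ h` as `S₁` and `S₂` act on `h`.

On the residual part, `‖Q Sᵢ x‖ = ‖Q x‖`, so the isometry `X*` factors into commuting isometries of
the closure of `Ran Q`. These lift to commuting unitaries on the minimal unitary extension
(`IsMinimalUnitaryExtension.exists_factorization`). Together the two parts make `dilationIso`
intertwine the model adjoints with `S₁` and `S₂`. An intertwining isometry has co-invariant range,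
and the compressions to it are copies of the original operators.

For (D) the symbols are compressed by `Γ`. The compressed operators need be neither isometric nor
commuting, but they are contractions, and the same intertwining survives with `Γ` replaced by the
identity. -/

theorem prod_ext {α : Type u} {β : Type v} {x y : WithLp 2 (α × β)} (h₁ : x.fst = y.fst)
    (h₂ : x.snd = y.snd) : x = y :=
  WithLp.ofLp_injective _ (Prod.ext h₁ h₂)

/-! ### Calculus of operators `A ⊕ B`. -/

section DirectSum

variable {H : Type u} [NormedAddCommGroup H] [InnerProductSpace ℂ H]
variable {K : Type v} [NormedAddCommGroup K] [InnerProductSpace ℂ K]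

@[simp] theorem directSum_fst (A : H →L[ℂ] H) (B : K →L[ℂ] K) (x : WithLp 2 (H × K)) :
    (directSum A B x).fst = A x.fst := rfl

@[simp] theorem directSum_snd (A : H →L[ℂ] H) (B : K →L[ℂ] K) (x : WithLp 2 (H × K)) :
    (directSum A B x).snd = B x.snd := rfl

theorem directSum_mul (A C : H →L[ℂ] H) (B D : K →L[ℂ] K) :
    directSum A B * directSum C D = directSum (A * C) (B * D) := rfl

theorem directSum_one : directSum (1 : H →L[ℂ] H) (1 : K →L[ℂ] K) = 1 := rfl

theorem adjoint_directSum [CompleteSpace H] [CompleteSpace K] (A : H →L[ℂ] H) (B : K →L[ℂ] K) :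
    adjoint (directSum A B) = directSum (adjoint A) (adjoint B) := by
  symm
  rw [eq_adjoint_iff]
  intro x y
  rw [WithLp.prod_inner_apply, WithLp.prod_inner_apply]
  exact congrArg₂ _ (adjoint_inner_left A _ _) (adjoint_inner_left B _ _)

theorem norm_directSum_le_one {A : H →L[ℂ] H} {B : K →L[ℂ] K} (hA : ‖A‖ ≤ 1) (hB : ‖B‖ ≤ 1) :
    ‖directSum A B‖ ≤ 1 := by
  refine opNorm_le_bound _ zero_le_one fun x => ?_
  rw [one_mul]
  refine le_of_sq_le_sq ?_ (norm_nonneg _)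
  rw [WithLp.prod_norm_sq_eq_of_L2, WithLp.prod_norm_sq_eq_of_L2 x, directSum_fst, directSum_snd]
  have h₁ := A.le_of_opNorm_le hA x.fst
  have h₂ := B.le_of_opNorm_le hB x.snd
  rw [one_mul] at h₁ h₂
  gcongr

theorem isStarProjection_directSum [CompleteSpace H] [CompleteSpace K] {A : H →L[ℂ] H}
    {B : K →L[ℂ] K} (hA : IsStarProjection A) (hB : IsStarProjection B) :
    IsStarProjection (directSum A B) := by
  refine ⟨?_, ?_⟩
  · rw [IsIdempotentElem, directSum_mul, hA.1.eq, hB.1.eq]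
  · rw [isSelfAdjoint_iff, star_eq_adjoint, adjoint_directSum]
    exact congrArg₂ _ hA.2.star_eq hB.2.star_eq

end DirectSum

/-! ### Multiplication operators with affine symbol and their adjoints. -/

section MulAffine

variable {F : Type u} [NormedAddCommGroup F] [InnerProductSpace ℂ F]
variable {E : Type v} [NormedAddCommGroup E] [InnerProductSpace ℂ E]

@[simp] theorem mulAffine_apply_zero (A B : F →L[ℂ] F) (f : Hardy F) :
    mulAffine A B f 0 = A (f 0) := by
  change A (f 0) + (0 : F) = A (f 0)
  rw [add_zero]

@[simp] theorem mulAffine_apply_succ (A B : F →L[ℂ] F) (f : Hardy F) (n : ℕ) :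
    mulAffine A B f (n + 1) = A (f (n + 1)) + B (f n) := rfl

theorem mulAffine_single (A B : F →L[ℂ] F) (n : ℕ) (x : F) :
    mulAffine A B (lp.single 2 n x) = lp.single 2 n (A x) + lp.single 2 (n + 1) (B x) := by
  ext m
  cases m with
  | zero =>
    cases n <;> simp [lp.single_apply]
  | succ m =>
    simp only [mulAffine_apply_succ, lp.single_apply, Pi.single_apply, lp.coeFn_add, Pi.add_apply,
      add_left_inj]
    split_ifs <;> simp

theorem hardyShift_eq_mulAffine : hardyShift F = mulAffine 0 1 := by
  ext f n
  cases n <;> simp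

/-- The three hypotheses are the coefficients of `1`, `z²` and `z` in `(A + zB)(C + zD) = z`. -/
theorem mulAffine_mul (A B C D : F →L[ℂ] F) (hAC : A * C = 0) (hBD : B * D = 0)
    (h : A * D + B * C = 1) : mulAffine A B * mulAffine C D = hardyShift F := by
  have hAC' : ∀ x, A (C x) = 0 := fun x => DFunLike.congr_fun hAC x
  have hBD' : ∀ x, B (D x) = 0 := fun x => DFunLike.congr_fun hBD x
  have h' : ∀ x, A (D x) + B (C x) = x := fun x => DFunLike.congr_fun h x
  ext f n
  rw [opMul_apply]
  match n with
  | 0 => simp [hAC']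
  | 1 => simp [hAC', h']
  | n + 2 => simp [hAC', hBD', h']

theorem norm_hardyMap_le (A : F →L[ℂ] E) : ‖hardyMap A‖ ≤ ‖A‖ :=
  LinearMap.mkContinuous_norm_le _ (norm_nonneg _) _

theorem inner_hardy_single_left (n : ℕ) (x : F) (f : Hardy F) :
    inner ℂ (lp.single (E := fun _ : ℕ => F) 2 n x) f = inner ℂ x (f n) :=
  lp.inner_single_left n x f

variable [CompleteSpace F] [CompleteSpace E]

/-- Pairing with the monomial `zⁿx` isolates the coefficient, and `M_φ` sends `zⁿx` to `zⁿAx +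
zⁿ⁺¹Bx`. -/
theorem adjoint_mulAffine_apply (A B : F →L[ℂ] F) (f : Hardy F) (n : ℕ) :
    adjoint (mulAffine A B) f n = adjoint A (f n) + adjoint B (f (n + 1)) := by
  refine ext_inner_left ℂ fun (x : F) => ?_
  refine (inner_hardy_single_left n x _).symm.trans ?_
  rw [adjoint_inner_right, mulAffine_single, inner_add_left, inner_hardy_single_left,
    inner_hardy_single_left, inner_add_right, adjoint_inner_right,
    adjoint_inner_right]

theorem adjoint_one_apply (x : F) : adjoint (1 : F →L[ℂ] F) x = x :=
  DFunLike.congr_fun (star_one (F →L[ℂ] F)) x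

/-- The hypotheses say that `(A + zB)*(A + zB) = 1` on the unit circle, that is, that the symbol is
inner. The coefficient `B*A` vanishes because it is the adjoint of `A*B`. -/
theorem adjoint_mul_mulAffine (A B : F →L[ℂ] F) (h : adjoint A * A + adjoint B * B = 1)
    (hAB : adjoint A * B = 0) : adjoint (mulAffine A B) * mulAffine A B = 1 := by
  have h' : ∀ x, adjoint A (A x) + adjoint B (B x) = x := fun x => DFunLike.congr_fun h x
  have hAB' : ∀ x, adjoint A (B x) = 0 := fun x => DFunLike.congr_fun hAB x
  have hBA' : ∀ x, adjoint B (A x) = 0 := by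
    have := congrArg adjoint hAB
    rw [← star_eq_adjoint, star_mul, star_eq_adjoint, star_eq_adjoint, adjoint_adjoint,
      map_zero] at this
    exact fun x => DFunLike.congr_fun this x
  ext f n
  rw [opMul_apply, adjoint_mulAffine_apply]
  cases n <;> simp [hAB', hBA', h']

/-- Compressing the symbol amounts to compressing the operator: it becomes `(I ⊗ Γ*) M (I ⊗ Γ)`,
with contractions on both sides. -/
theorem norm_mulAffine_compressTo_le (Γ : E →ₗᵢ[ℂ] F) (A B : F →L[ℂ] F)
    (h : ‖mulAffine A B‖ ≤ 1) : ‖mulAffine (compressTo Γ A) (compressTo Γ B)‖ ≤ 1 := by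
  have hΓ : ‖Γ.toContinuousLinearMap‖ ≤ 1 := Γ.norm_toContinuousLinearMap_le
  have hfac : mulAffine (compressTo Γ A) (compressTo Γ B) =
      (hardyMap (adjoint Γ.toContinuousLinearMap)).comp
        ((mulAffine A B).comp (hardyMap Γ.toContinuousLinearMap)) := by
    ext f n
    cases n <;> simp [compressTo]
  rw [hfac]
  refine (opNorm_comp_le _ _).trans (mul_le_one₀ ?_ (norm_nonneg _)
    ((opNorm_comp_le _ _).trans (mul_le_one₀ h (norm_nonneg _) ((norm_hardyMap_le _).trans hΓ))))
  refine (norm_hardyMap_le _).trans ?_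
  rwa [LinearIsometryEquiv.norm_map]

theorem adjoint_compressTo (Γ : E →ₗᵢ[ℂ] F) (A : F →L[ℂ] F) :
    adjoint (compressTo Γ A) = compressTo Γ (adjoint A) := by
  rw [compressTo, adjoint_comp, adjoint_comp, adjoint_adjoint]
  rfl

theorem adjoint_toContinuousLinearMap_apply (Γ : E →ₗᵢ[ℂ] F) (x : E) :
    adjoint Γ.toContinuousLinearMap (Γ x) = x := by
  refine ext_inner_left ℂ fun y => ?_
  rw [adjoint_inner_right]
  exact Γ.inner_map_map y x

end MulAffine

/-! ### Compressions to co-invariant subspaces and intertwining isometries. -/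

section Intertwining

variable {H : Type u} [NormedAddCommGroup H] [InnerProductSpace ℂ H]
variable {K : Type v} [NormedAddCommGroup K] [InnerProductSpace ℂ K]

theorem commutingFactorization_of_unitarilyEquivalent {T₁ T₂ T : H →L[ℂ] H}
    {B₁ B₂ B : K →L[ℂ] K} (h : UnitarilyEquivalent T₁ T₂ T B₁ B₂ B)
    (h₁₂ : B = B₁ * B₂) (h₂₁ : B = B₂ * B₁) : CommutingFactorization T₁ T₂ T := by
  obtain ⟨τ, hτ⟩ := h
  have e₁₂ : T = T₁ * T₂ := by
    ext x
    apply τ.injective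
    rw [(hτ x).2.2, opMul_apply, (hτ (T₂ x)).1, (hτ x).2.1, h₁₂, opMul_apply]
  have e₂₁ : T = T₂ * T₁ := by
    ext x
    apply τ.injective
    rw [(hτ x).2.2, opMul_apply, (hτ (T₁ x)).2.1, (hτ x).1, h₂₁, opMul_apply]
  exact ⟨e₁₂.symm.trans e₂₁, e₁₂⟩

variable [CompleteSpace H] [CompleteSpace K]

/-- For `y ∈ M` the vector `A*y` lies in `M`, so the pairing `⟨A*y, Bx⟩` does not change when `Bx`
is projected to `M`. Only the left factor has to be co-invariant. -/
theorem compression_mul (M : Submodule ℂ K) [CompleteSpace M] {A : K →L[ℂ] K}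
    (hA : Coinvariant M A) (B : K →L[ℂ] K) :
    compression M (A * B) = compression M A * compression M B := by
  ext x
  congr 1
  refine ext_inner_left ℂ fun y => ?_
  have h : ∀ z : K, inner ℂ y (M.orthogonalProjectionOnto z) = inner ℂ (y : K) z := fun z =>
    Submodule.inner_orthogonalProjectionOnto_eq_of_mem_left _ _
  change inner ℂ y (M.orthogonalProjectionOnto (A (B x))) =
    inner ℂ y (M.orthogonalProjectionOnto (A (M.orthogonalProjectionOnto (B x))))
  rw [h, h, ← adjoint_inner_left A, ← adjoint_inner_left A]
  exact (Submodule.inner_orthogonalProjectionOnto_eq_of_mem_left (⟨_, hA y y.2⟩ : M) (B x)).symm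

theorem coinvariant_range {J : H →ₗᵢ[ℂ] K} {A : K →L[ℂ] K} {S : H →L[ℂ] H}
    (h : ∀ x, adjoint A (J x) = J (adjoint S x)) :
    Coinvariant (LinearMap.range J.toLinearMap) A := by
  rintro _ ⟨x, rfl⟩
  exact ⟨adjoint S x, (h x).symm⟩

/-- `⟨Jy, AJx⟩ = ⟨A*Jy, Jx⟩ = ⟨JS*y, Jx⟩ = ⟨S*y, x⟩ = ⟨y, Sx⟩`. -/
theorem compression_range_apply {J : H →ₗᵢ[ℂ] K} [CompleteSpace (LinearMap.range J.toLinearMap)]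
    {A : K →L[ℂ] K} {S : H →L[ℂ] H} (h : ∀ x, adjoint A (J x) = J (adjoint S x)) (x : H) :
    compression (LinearMap.range J.toLinearMap) A (J.equivRange x) = J.equivRange (S x) := by
  refine ext_inner_left ℂ fun y => ?_
  obtain ⟨y, rfl⟩ := J.equivRange.surjective y
  have h₁ : inner ℂ (J.equivRange y)
      (compression (LinearMap.range J.toLinearMap) A (J.equivRange x)) =
      inner ℂ (J y) (A (J x)) :=
    Submodule.inner_orthogonalProjectionOnto_eq_of_mem_left _ _
  rw [h₁, LinearIsometryEquiv.inner_map_map, ← adjoint_inner_left, h, J.inner_map_map,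
    adjoint_inner_left]

/-- This supplies the compression identities of (D): `V_D`, `D₁D₂` and `D₂D₁` may differ on the
whole space, but all of them intertwine with `T`. -/
theorem compression_range_congr {J : H →ₗᵢ[ℂ] K} [CompleteSpace (LinearMap.range J.toLinearMap)]
    {A B : K →L[ℂ] K} {S : H →L[ℂ] H} (hA : ∀ x, adjoint A (J x) = J (adjoint S x))
    (hB : ∀ x, adjoint B (J x) = J (adjoint S x)) :
    compression (LinearMap.range J.toLinearMap) A =
      compression (LinearMap.range J.toLinearMap) B := by
  refine ContinuousLinearMap.ext fun x => ?_
  obtain ⟨x, rfl⟩ := J.equivRange.surjective x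
  rw [compression_range_apply hA, compression_range_apply hB]

theorem unitarilyEquivalent_compression_range {J : H →ₗᵢ[ℂ] K}
    [CompleteSpace (LinearMap.range J.toLinearMap)]
    {A₁ A₂ A₃ : K →L[ℂ] K} {S₁ S₂ S₃ : H →L[ℂ] H}
    (h₁ : ∀ x, adjoint A₁ (J x) = J (adjoint S₁ x))
    (h₂ : ∀ x, adjoint A₂ (J x) = J (adjoint S₂ x))
    (h₃ : ∀ x, adjoint A₃ (J x) = J (adjoint S₃ x)) :
    UnitarilyEquivalent (K := LinearMap.range J.toLinearMap) S₁ S₂ S₃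
      (compression _ A₁) (compression _ A₂) (compression _ A₃) :=
  ⟨J.equivRange, fun x => ⟨(compression_range_apply h₁ x).symm,
    (compression_range_apply h₂ x).symm, (compression_range_apply h₃ x).symm⟩⟩

theorem adjoint_mul_intertwine {J : H →ₗᵢ[ℂ] K} {A B : K →L[ℂ] K} {S T : H →L[ℂ] H}
    (hA : ∀ x, adjoint A (J x) = J (adjoint S x)) (hB : ∀ x, adjoint B (J x) = J (adjoint T x))
    (x : H) : adjoint (A * B) (J x) = J (adjoint (S * T) x) := by
  rw [← star_eq_adjoint, ← star_eq_adjoint, star_mul, star_mul]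
  exact (congrArg (adjoint B) (hA x)).trans (hB _)

theorem commutingFactorization_of_andoModel {T₁ T₂ T : H →L[ℂ] H} (h : AndoModel T₁ T₂ T) :
    CommutingFactorization T₁ T₂ T := by
  obtain ⟨F, _, _, _, R, _, _, _, P, U, W₁, W₂, -, -, M, _, -, -, hc, h₁, h₂, he⟩ := h
  refine commutingFactorization_of_unitarilyEquivalent he (compression_mul M h₁ _) ?_
  rw [hc.eq, compression_mul M h₂]

theorem commutingFactorization_of_douglasModel {T₁ T₂ T : H →L[ℂ] H} {W : unitary (K →L[ℂ] K)}
    (h : DouglasModel T₁ T₂ T W) : CommutingFactorization T₁ T₂ T := by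
  obtain ⟨D₁, D₂, -, -, M, _, h₁, h₂, -, he, h₁₂, h₂₁⟩ := h
  exact commutingFactorization_of_unitarilyEquivalent he (h₁₂.trans (compression_mul M h₁ _))
    (h₂₁.trans (compression_mul M h₂ _))

end Intertwining

/-! ### Extending isometries to unitaries on a doubled space. -/

section Extension

/-- The parameter space `D` carries no topology, so that it can also be a space of finitely
supported sequences. Equality of norms makes `e x ↦ f x` well defined and isometric, and density
extends it. -/
theorem exists_isometry_of_denseRange {D : Type w} [AddCommGroup D] [Module ℂ D]
    {E : Type u} [NormedAddCommGroup E] [InnerProductSpace ℂ E]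
    {F : Type v} [NormedAddCommGroup F] [InnerProductSpace ℂ F] [CompleteSpace F]
    (e : D →ₗ[ℂ] E) (f : D →ₗ[ℂ] F) (he : DenseRange e) (h : ∀ x, ‖f x‖ = ‖e x‖) :
    ∃ V : E →ₗᵢ[ℂ] F, ∀ x, V (e x) = f x := by
  have heq : ∀ x, f.extendOfNorm e (e x) = f x :=
    LinearMap.extendOfNorm_eq he ⟨1, fun x => by rw [one_mul, h]⟩
  refine ⟨⟨(f.extendOfNorm e).toLinearMap, fun x => ?_⟩, heq⟩
  refine he.induction (P := fun x => ‖f.extendOfNorm e x‖ = ‖x‖) ?_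
    (isClosed_eq (by fun_prop) (by fun_prop)) x
  rintro _ ⟨y, rfl⟩
  rw [heq, h]

variable {K : Type u} [NormedAddCommGroup K] [InnerProductSpace ℂ K]

/-- The operator on `K ⊕ K` with a given matrix of operators on `K`. -/
def blockOp (A B C D : K →L[ℂ] K) : WithLp 2 (K × K) →L[ℂ] WithLp 2 (K × K) :=
  ((WithLp.prodContinuousLinearEquiv 2 ℂ K K).symm : (K × K) →L[ℂ] WithLp 2 (K × K)).comp
    (((A.coprod B).prod (C.coprod D)).comp
      (WithLp.prodContinuousLinearEquiv 2 ℂ K K : WithLp 2 (K × K) →L[ℂ] (K × K)))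

@[simp] theorem blockOp_fst (A B C D : K →L[ℂ] K) (x : WithLp 2 (K × K)) :
    (blockOp A B C D x).fst = A x.fst + B x.snd := rfl

@[simp] theorem blockOp_snd (A B C D : K →L[ℂ] K) (x : WithLp 2 (K × K)) :
    (blockOp A B C D x).snd = C x.fst + D x.snd := rfl

theorem blockOp_mul (A B C D A' B' C' D' : K →L[ℂ] K) :
    blockOp A B C D * blockOp A' B' C' D' =
      blockOp (A * A' + B * C') (A * B' + B * D') (C * A' + D * C') (C * B' + D * D') := by
  refine ContinuousLinearMap.ext fun x => prod_ext ?_ ?_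
  · rw [opMul_apply, blockOp_fst, blockOp_fst, blockOp_snd, blockOp_fst]
    simp only [map_add, add_apply, opMul_apply]
    abel
  · rw [opMul_apply, blockOp_snd, blockOp_fst, blockOp_snd, blockOp_snd]
    simp only [map_add, add_apply, opMul_apply]
    abel

theorem blockOp_one : blockOp (1 : K →L[ℂ] K) 0 0 1 = 1 := by
  refine ContinuousLinearMap.ext fun x => prod_ext ?_ ?_
  · exact add_zero _
  · exact zero_add _

theorem adjoint_blockOp [CompleteSpace K] (A B C D : K →L[ℂ] K) :
    adjoint (blockOp A B C D) = blockOp (adjoint A) (adjoint C) (adjoint B) (adjoint D) := by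
  symm
  rw [eq_adjoint_iff]
  intro x y
  rw [WithLp.prod_inner_apply, WithLp.prod_inner_apply]
  change inner ℂ (adjoint A x.fst + adjoint C x.snd) y.fst +
      inner ℂ (adjoint B x.fst + adjoint D x.snd) y.snd =
    inner ℂ x.fst (A y.fst + B y.snd) + inner ℂ x.snd (C y.fst + D y.snd)
  simp only [inner_add_left, inner_add_right, adjoint_inner_left]
  ring

/-- The unitary dilation of a partial isometry. -/
theorem exists_unitary_of_partialIsometry [CompleteSpace K] (V : K →L[ℂ] K)
    (hV : V * adjoint V * V = V) :
    ∃ U : unitary (WithLp 2 (K × K) →L[ℂ] WithLp 2 (K × K)),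
      (U : WithLp 2 (K × K) →L[ℂ] WithLp 2 (K × K)) =
        blockOp V (1 - V * adjoint V) (1 - adjoint V * V) (-adjoint V) := by
  have hV' : adjoint V * V * adjoint V = adjoint V := by
    have := congrArg star hV
    simpa only [star_mul, ← star_eq_adjoint, star_star, mul_assoc] using this
  have h₁ : V * (adjoint V * V) = V := by rw [← mul_assoc, hV]
  have h₂ : adjoint V * (V * adjoint V) = adjoint V := by rw [← mul_assoc, hV']
  have hadj : star (blockOp V (1 - V * adjoint V) (1 - adjoint V * V) (-adjoint V)) =
      blockOp (adjoint V) (1 - adjoint V * V) (1 - V * adjoint V) (-V) := by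
    rw [star_eq_adjoint, adjoint_blockOp]
    simp only [← star_eq_adjoint, star_sub, star_one, star_mul, star_star, star_neg]
  -- For a partial isometry `1 - VV*` and `1 - V*V` are projections, hence their own square roots,
  -- so this is the Halmos dilation of `V`.
  have hU : blockOp V (1 - V * adjoint V) (1 - adjoint V * V) (-adjoint V) ∈
      unitary (WithLp 2 (K × K) →L[ℂ] WithLp 2 (K × K)) := by
    rw [Unitary.mem_iff, hadj, blockOp_mul, blockOp_mul, ← blockOp_one]
    constructor <;> congr 1 <;> simp [mul_sub, sub_mul, mul_assoc, h₁, h₂]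
  exact ⟨⟨_, hU⟩, rfl⟩

/-- If `‖a x‖ = ‖b x‖` for all `x`, then some unitary operator on `K ⊕ K` maps every `a x ⊕ 0` to
`b x ⊕ 0`. -/
theorem exists_unitary_extension [CompleteSpace K] {D : Type w} [AddCommGroup D] [Module ℂ D]
    (a b : D →ₗ[ℂ] K) (h : ∀ x, ‖b x‖ = ‖a x‖) :
    ∃ U : unitary (WithLp 2 (K × K) →L[ℂ] WithLp 2 (K × K)),
      ∀ x, (U : WithLp 2 (K × K) →L[ℂ] WithLp 2 (K × K)) (WithLp.toLp 2 (a x, 0)) =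
        WithLp.toLp 2 (b x, 0) := by
  set M : Submodule ℂ K := (LinearMap.range a).topologicalClosure with hM
  let e : D →ₗ[ℂ] M := a.codRestrict M fun x => Submodule.le_topologicalClosure _ ⟨x, rfl⟩
  have he : DenseRange e := by
    rw [DenseRange, Subtype.dense_iff]
    intro x hx
    rw [← Set.range_comp]
    exact hx
  obtain ⟨S, hS⟩ := exists_isometry_of_denseRange e b he h
  let S' := S.toContinuousLinearMap
  -- The partial isometry with initial space `M`. The orthogonal complements of its initial and
  -- final spaces may have different dimensions, which is why the unitary is sought on `K ⊕ K`.
  let V : K →L[ℂ] K := S'.comp M.orthogonalProjectionOnto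
  have hadj : adjoint V = M.subtypeL.comp (adjoint S') := by
    rw [adjoint_comp, Submodule.adjoint_orthogonalProjectionOnto]
  have hVV : ∀ y : M, adjoint V (V y) = y := by
    intro y
    rw [hadj]
    change ((adjoint S' (S (M.orthogonalProjectionOnto (y : K))) : M) : K) = y
    rw [Submodule.orthogonalProjectionOnto_mem_subspace_eq_self,
      adjoint_toContinuousLinearMap_apply]
  have hV : V * adjoint V * V = V := by
    ext x
    have hVx : V x = V (M.orthogonalProjectionOnto x : M) := by
      exact congrArg S
        (Submodule.orthogonalProjectionOnto_mem_subspace_eq_self _).symm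
    rw [opMul_apply, opMul_apply, hVx, hVV]
  have hVa : ∀ x, V (a x) = b x := by
    intro x
    change S (M.orthogonalProjectionOnto (e x : K)) = b x
    rw [Submodule.orthogonalProjectionOnto_mem_subspace_eq_self, hS]
  obtain ⟨U, hU⟩ := exists_unitary_of_partialIsometry V hV
  refine ⟨U, fun x => ?_⟩
  rw [hU]
  refine prod_ext ?_ ?_
  · rw [blockOp_fst]
    change V (a x) + (1 - V * adjoint V) 0 = b x
    rw [map_zero, add_zero, hVa]
  -- The second coordinate is `(1 - V*V) a x`, which is zero because `a x` lies in the initial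
  -- space.
  · rw [blockOp_snd]
    change (a x - adjoint V (V (a x))) + (-adjoint V) 0 = 0
    rw [map_zero, add_zero, sub_eq_zero]
    exact (hVV (e x)).symm

end Extension

/-! ### Lifting commuting isometries to the minimal unitary extension. -/

section UnitaryLift

variable {K : Type u} [NormedAddCommGroup K] [InnerProductSpace ℂ K]
variable {R : Type v} [NormedAddCommGroup R] [InnerProductSpace ℂ R] [CompleteSpace R]

/-- The map `(k_n) ↦ ∑ Y⁻ⁿ k_n` on finitely supported sequences. -/
def zpowSum (ι : K →ₗᵢ[ℂ] R) (Y : unitary (R →L[ℂ] R)) : (ℕ →₀ K) →ₗ[ℂ] R :=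
  Finsupp.lsum ℂ fun n => (((Y⁻¹ ^ n : unitary (R →L[ℂ] R)) : R →L[ℂ] R) : R →ₗ[ℂ] R) ∘ₗ
    ι.toLinearMap

@[simp] theorem zpowSum_single (ι : K →ₗᵢ[ℂ] R) (Y : unitary (R →L[ℂ] R)) (n : ℕ) (k : K) :
    zpowSum ι Y (Finsupp.single n k) = ((Y⁻¹ ^ n : unitary (R →L[ℂ] R)) : R →L[ℂ] R) (ι k) := by
  simp [zpowSum]

variable {V : K →ₗᵢ[ℂ] K} {ι : K →ₗᵢ[ℂ] R} {Y : unitary (R →L[ℂ] R)}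

theorem IsMinimalUnitaryExtension.pow_apply (h : IsMinimalUnitaryExtension V ι Y) (n : ℕ) (k : K) :
    ((Y ^ n : unitary (R →L[ℂ] R)) : R →L[ℂ] R) (ι k) = ι ((V ^ n) k) := by
  induction n generalizing k with
  | zero => simp
  | succ n ih =>
    rw [unitary_pow_succ_apply, h.extends_isometry, ih, pow_succ]
    rfl

/-- Nonnegative powers of `Y` map `ι K` into itself, so the nonpositive powers already span a dense
subspace. -/
theorem IsMinimalUnitaryExtension.denseRange_zpowSum (h : IsMinimalUnitaryExtension V ι Y) :
    DenseRange (zpowSum ι Y) := by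
  have hle : Submodule.span ℂ {x : R | ∃ (n : ℤ) (k : K),
      x = ((Y ^ n : unitary (R →L[ℂ] R)) : R →L[ℂ] R) (ι k)} ≤ LinearMap.range (zpowSum ι Y) := by
    rw [Submodule.span_le]
    rintro _ ⟨n, k, rfl⟩
    obtain ⟨n, rfl | rfl⟩ := n.eq_nat_or_neg
    · refine ⟨Finsupp.single 0 ((V ^ n) k), ?_⟩
      rw [zpowSum_single, zpow_natCast, h.pow_apply]
      simp
    · refine ⟨Finsupp.single n k, ?_⟩
      rw [zpowSum_single, zpow_neg, zpow_natCast, inv_pow]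
  have htop := Submodule.topologicalClosure_mono hle
  rw [h.minimal, top_le_iff] at htop
  exact (Submodule.dense_iff_topologicalClosure_eq_top).2 htop

theorem IsMinimalUnitaryExtension.ext (h : IsMinimalUnitaryExtension V ι Y) {A B : R →L[ℂ] R}
    (hAB : ∀ n k, A (((Y⁻¹ ^ n : unitary (R →L[ℂ] R)) : R →L[ℂ] R) (ι k)) =
      B (((Y⁻¹ ^ n : unitary (R →L[ℂ] R)) : R →L[ℂ] R) (ι k))) : A = B := by
  have hlin : (A : R →ₗ[ℂ] R) ∘ₗ zpowSum ι Y = (B : R →ₗ[ℂ] R) ∘ₗ zpowSum ι Y :=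
    Finsupp.lhom_ext fun n k => by simpa using hAB n k
  have := h.denseRange_zpowSum.equalizer A.continuous B.continuous
    (funext fun f => LinearMap.congr_fun hlin f)
  exact DFunLike.coe_injective this

theorem IsMinimalUnitaryExtension.inv_pow_add_apply (h : IsMinimalUnitaryExtension V ι Y)
    (m n : ℕ) (k : K) :
    ((Y⁻¹ ^ (m + n) : unitary (R →L[ℂ] R)) : R →L[ℂ] R) (ι ((V ^ n) k)) =
      ((Y⁻¹ ^ m : unitary (R →L[ℂ] R)) : R →L[ℂ] R) (ι k) := by
  rw [← h.pow_apply, ← opMul_apply, ← Submonoid.coe_mul, pow_add, mul_assoc, inv_pow Y n,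
    inv_mul_cancel, mul_one]

/-- The subspaces `Y⁻ⁿ ι K` increase with `n`, so a finite sum can be brought to a common
denominator. The pair `(N, g)` serves every `A` at once, which allows a comparison of `A` with the
identity. -/
theorem IsMinimalUnitaryExtension.exists_zpowSum_eq (h : IsMinimalUnitaryExtension V ι Y)
    (f : ℕ →₀ K) : ∃ (N : ℕ) (g : K), ∀ A : K →ₗᵢ[ℂ] K, Commute A V →
      zpowSum ι Y (Finsupp.mapRange.linearMap A.toLinearMap f) =
        ((Y⁻¹ ^ N : unitary (R →L[ℂ] R)) : R →L[ℂ] R) (ι (A g)) := by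
  induction f using Finsupp.induction_linear with
  | zero => exact ⟨0, 0, fun A _ => by simp⟩
  | add f₁ f₂ h₁ h₂ =>
    obtain ⟨N₁, g₁, h₁⟩ := h₁
    obtain ⟨N₂, g₂, h₂⟩ := h₂
    refine ⟨N₁ + N₂, (V ^ N₂) g₁ + (V ^ N₁) g₂, fun A hA => ?_⟩
    have hc : ∀ (n : ℕ) (k : K), A ((V ^ n) k) = (V ^ n) (A k) := fun n k =>
      DFunLike.congr_fun (hA.pow_right n).eq k
    rw [map_add, map_add, h₁ A hA, h₂ A hA, map_add, map_add, map_add, hc, hc,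
      h.inv_pow_add_apply, add_comm N₁, h.inv_pow_add_apply]
  | single n k =>
    refine ⟨n, k, fun A _ => ?_⟩
    rw [Finsupp.mapRange.linearMap_apply, Finsupp.mapRange_single, zpowSum_single]
    rfl

/-- An isometry that commutes with `V` extends to an isometry of the space of the minimal unitary
extension. -/
theorem IsMinimalUnitaryExtension.exists_lift (h : IsMinimalUnitaryExtension V ι Y)
    (A : K →ₗᵢ[ℂ] K) (hA : Commute A V) :
    ∃ B : R →ₗᵢ[ℂ] R, ∀ n k, B (((Y⁻¹ ^ n : unitary (R →L[ℂ] R)) : R →L[ℂ] R) (ι k)) =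
      ((Y⁻¹ ^ n : unitary (R →L[ℂ] R)) : R →L[ℂ] R) (ι (A k)) := by
  have hnorm : ∀ (n : ℕ) (x : R), ‖((Y⁻¹ ^ n : unitary (R →L[ℂ] R)) : R →L[ℂ] R) x‖ = ‖x‖ :=
    fun n x => (Unitary.linearIsometryEquiv (Y⁻¹ ^ n)).norm_map x
  obtain ⟨B, hB⟩ := exists_isometry_of_denseRange (zpowSum ι Y)
    (zpowSum ι Y ∘ₗ Finsupp.mapRange.linearMap A.toLinearMap) h.denseRange_zpowSum (fun f => by
      obtain ⟨N, g, hf⟩ := h.exists_zpowSum_eq f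
      -- With `A` and with the identity the sums are `Y⁻ᴺ ι (A g)` and `Y⁻ᴺ ι g`, and these have
      -- equal norms.
      have h₁ := hf 1 (Commute.one_left V)
      have hid : Finsupp.mapRange.linearMap (1 : K →ₗᵢ[ℂ] K).toLinearMap f = f :=
        LinearMap.congr_fun Finsupp.mapRange.linearMap_id f
      rw [hid] at h₁
      rw [LinearMap.comp_apply, hf A hA, h₁, hnorm, hnorm, ι.norm_map, ι.norm_map, A.norm_map]
      rfl)
  refine ⟨B, fun n k => ?_⟩
  have := hB (Finsupp.single n k)
  rw [LinearMap.comp_apply, Finsupp.mapRange.linearMap_apply, Finsupp.mapRange_single,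
    zpowSum_single, zpowSum_single] at this
  exact this

/-- A factorization of `V` into commuting isometries extends to a factorization of its minimal
unitary extension into commuting unitary operators. -/
theorem IsMinimalUnitaryExtension.exists_factorization (h : IsMinimalUnitaryExtension V ι Y)
    (A₁ A₂ : K →ₗᵢ[ℂ] K) (h₁₂ : A₁ * A₂ = V) (h₂₁ : A₂ * A₁ = V) :
    ∃ Y₁ Y₂ : unitary (R →L[ℂ] R), Commute Y₁ Y₂ ∧ Y₁ * Y₂ = Y ∧
      (∀ k, (Y₁ : R →L[ℂ] R) (ι k) = ι (A₁ k)) ∧ ∀ k, (Y₂ : R →L[ℂ] R) (ι k) = ι (A₂ k) := by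
  have c₁ : Commute A₁ V := by
    rw [commute_iff_eq, ← h₁₂, mul_assoc, h₂₁, h₁₂]
  have c₂ : Commute A₂ V := by
    rw [commute_iff_eq, ← h₂₁, mul_assoc, h₁₂, h₂₁]
  have key : ∀ {A A' : K →ₗᵢ[ℂ] K} {B B' : R →ₗᵢ[ℂ] R}, A * A' = V →
      (∀ n k, B (((Y⁻¹ ^ n : unitary (R →L[ℂ] R)) : R →L[ℂ] R) (ι k)) =
        ((Y⁻¹ ^ n : unitary (R →L[ℂ] R)) : R →L[ℂ] R) (ι (A k))) →
      (∀ n k, B' (((Y⁻¹ ^ n : unitary (R →L[ℂ] R)) : R →L[ℂ] R) (ι k)) =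
        ((Y⁻¹ ^ n : unitary (R →L[ℂ] R)) : R →L[ℂ] R) (ι (A' k))) →
      B.toContinuousLinearMap * B'.toContinuousLinearMap = Y := by
    intro A A' B B' hA hB hB'
    refine h.ext fun n k => ?_
    change B (B' _) = _
    rw [hB', hB, ← opMul_apply, ← Submonoid.coe_mul, ((Commute.refl Y).inv_right.pow_right n).eq,
      Submonoid.coe_mul, opMul_apply, h.extends_isometry, ← hA]
    rfl
  have hunit : ∀ {B B' : R →ₗᵢ[ℂ] R},
      B.toContinuousLinearMap * B'.toContinuousLinearMap = Y →
      B.toContinuousLinearMap ∈ unitary (R →L[ℂ] R) := by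
    intro B B' hB
    have h₁ : star B.toContinuousLinearMap * B.toContinuousLinearMap = 1 :=
      ContinuousLinearMap.ext fun x => adjoint_toContinuousLinearMap_apply B x
    refine Unitary.mem_iff.2 ⟨h₁, ?_⟩
    -- An isometry is unitary as soon as it has a right inverse, and `B B' = Y` provides `B' Y*`.
    have h₂ : B.toContinuousLinearMap * (B'.toContinuousLinearMap * star (Y : R →L[ℂ] R)) = 1 := by
      rw [← mul_assoc, hB, Unitary.mul_star_self_of_mem Y.2]
    rw [left_inv_eq_right_inv h₁ h₂, h₂]
  obtain ⟨B₁, hB₁⟩ := h.exists_lift A₁ c₁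
  obtain ⟨B₂, hB₂⟩ := h.exists_lift A₂ c₂
  have e₁₂ := key h₁₂ hB₁ hB₂
  have e₂₁ := key h₂₁ hB₂ hB₁
  refine ⟨⟨_, hunit e₁₂⟩, ⟨_, hunit e₂₁⟩, Subtype.ext (e₁₂.trans e₂₁.symm), Subtype.ext e₁₂,
    fun k => ?_, fun k => ?_⟩
  · simpa using hB₁ 0 k
  · simpa using hB₂ 0 k

end UnitaryLift

/-! ### The Douglas embedding: defect identities, `Q`, and the isometry `Π`. -/

section Dilation

variable {H : Type u} [NormedAddCommGroup H] [InnerProductSpace ℂ H] [CompleteSpace H]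

theorem norm_defect_sq (T : H →L[ℂ] H) (hT : ‖T‖ ≤ 1) (h : H) :
    ‖defect T h‖ ^ 2 = ‖h‖ ^ 2 - ‖T h‖ ^ 2 := by
  have hinner : ∀ x y, inner ℂ ((1 - adjoint T * T) x) y = inner ℂ x y - inner ℂ (T x) (T y) := by
    intro x y
    change inner ℂ (x - adjoint T (T x)) y = _
    rw [inner_sub_left, adjoint_inner_left]
  have hpos : 0 ≤ 1 - adjoint T * T := by
    rw [nonneg_iff_isPositive]
    refine ⟨fun x y => ?_, fun x => ?_⟩
    · refine (hinner x y).trans ?_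
      change _ = inner ℂ x ((1 - adjoint T * T) y)
      rw [← inner_conj_symm x ((1 - adjoint T * T) y), hinner, map_sub, inner_conj_symm,
        inner_conj_symm]
    · change 0 ≤ RCLike.re (inner ℂ ((1 - adjoint T * T) x) x)
      rw [hinner, map_sub, inner_self_eq_norm_sq, inner_self_eq_norm_sq, sub_nonneg]
      have := T.le_of_opNorm_le hT x
      rw [one_mul] at this
      gcongr
  have hsa : adjoint (defect T) = defect T :=
    ((nonneg_iff_isPositive _).1 (CFC.sqrt_nonneg (1 - adjoint T * T))).isSelfAdjoint
  have hsq : defect T (defect T h) = (1 - adjoint T * T) h := by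
    rw [← opMul_apply, defect, CFC.sqrt_mul_sqrt_self _ hpos]
  rw [← inner_self_eq_norm_sq (𝕜 := ℂ) (defect T h), ← adjoint_inner_left, hsa, hsq, hinner,
    map_sub, inner_self_eq_norm_sq, inner_self_eq_norm_sq]

theorem defectVec_denseRange (T : H →L[ℂ] H) : DenseRange (defectVec T) := by
  rw [DenseRange, Subtype.dense_iff]
  intro x hx
  rw [← Set.range_comp]
  exact hx

theorem norm_defectVec_sq (T : H →L[ℂ] H) (hT : ‖T‖ ≤ 1) (h : H) :
    ‖defectVec T h‖ ^ 2 = ‖h‖ ^ 2 - ‖T h‖ ^ 2 :=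
  norm_defect_sq T hT h

/-- `defectVec`, as a linear map. -/
def defectLin (T : H →L[ℂ] H) : H →ₗ[ℂ] defectSpace T where
  toFun := defectVec T
  map_add' x y := Subtype.ext (map_add (defect T) x y)
  map_smul' c x := Subtype.ext (map_smul (defect T) c x)

/-- Both sides are quadratic forms: `‖T*ⁿh‖² = ⟨TⁿT*ⁿh, h⟩`, and `⟨Q²h, h⟩ = ‖Qh‖²` because `Q` is
self-adjoint. -/
theorem tendsto_norm_adjoint_pow_sq (T : H →L[ℂ] H) (hT : ‖T‖ ≤ 1) (h : H) :
    Tendsto (fun n : ℕ => ‖(adjoint T ^ n) h‖ ^ 2) atTop (𝓝 (‖opQ T hT h‖ ^ 2)) := by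
  have h₀ : Tendsto (fun n : ℕ => RCLike.re (inner ℂ ((T ^ n) ((adjoint T ^ n) h)) h)) atTop
      (𝓝 (RCLike.re (inner ℂ (opQ T hT (opQ T hT h)) h))) :=
    (RCLike.continuous_re.tendsto _).comp ((opQ_tendsto T hT h).inner tendsto_const_nhds)
  have h₁ : inner ℂ (opQ T hT (opQ T hT h)) h = inner ℂ (opQ T hT h) (opQ T hT h) :=
    (opQ_isPositive T hT).1 _ _
  rw [h₁, inner_self_eq_norm_sq] at h₀
  refine h₀.congr fun n => ?_
  rw [inner_pow_adjoint, inner_self_eq_norm_sq]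

theorem hasSum_norm_defectVec_sq (T : H →L[ℂ] H) (hT : ‖T‖ ≤ 1) (h : H) :
    HasSum (fun n => ‖defectVec (adjoint T) ((adjoint T ^ n) h)‖ ^ 2)
      (‖h‖ ^ 2 - ‖opQ T hT h‖ ^ 2) := by
  rw [hasSum_iff_tendsto_nat_of_nonneg (fun n => by positivity)]
  refine ((tendsto_norm_adjoint_pow_sq T hT h).const_sub (‖h‖ ^ 2)).congr fun n => ?_
  -- The series telescopes, and what remains in the limit is `‖Qh‖²`.
  have hterm : ∀ i, ‖defectVec (adjoint T) ((adjoint T ^ i) h)‖ ^ 2 =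
      ‖(adjoint T ^ i) h‖ ^ 2 - ‖(adjoint T ^ (i + 1)) h‖ ^ 2 := fun i => by
    rw [norm_defectVec_sq _ (by rwa [LinearIsometryEquiv.norm_map]), ← opMul_apply, ← pow_succ']
  rw [Finset.sum_congr rfl fun i _ => hterm i,
    Finset.sum_range_sub' (fun i => ‖(adjoint T ^ i) h‖ ^ 2) n]
  simp

/-- Pass to the limit in `‖T*ⁿSh‖ = ‖ST*ⁿh‖ ≤ ‖T*ⁿh‖`. -/
theorem norm_opQ_le_of_commute (T : H →L[ℂ] H) (hT : ‖T‖ ≤ 1) {S : H →L[ℂ] H} (hS : ‖S‖ ≤ 1)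
    (hc : Commute S (adjoint T)) (h : H) : ‖opQ T hT (S h)‖ ≤ ‖opQ T hT h‖ := by
  refine le_of_sq_le_sq ?_ (norm_nonneg _)
  refine le_of_tendsto_of_tendsto' (tendsto_norm_adjoint_pow_sq T hT (S h))
    (tendsto_norm_adjoint_pow_sq T hT h) fun n => ?_
  rw [← opMul_apply, ← (hc.pow_right n).eq, opMul_apply]
  have := S.le_of_opNorm_le hS ((adjoint T ^ n) h)
  rw [one_mul] at this
  gcongr

/-- The chain `‖Qx‖ = ‖QT*x‖ = ‖QS'Sx‖ ≤ ‖QSx‖ ≤ ‖Qx‖` closes up: contractive factors of an operator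
that preserves `‖Q·‖` preserve it too. -/
theorem norm_opQ_eq_of_mul_eq (T : H →L[ℂ] H) (hT : ‖T‖ ≤ 1) {S S' : H →L[ℂ] H} (hS : ‖S‖ ≤ 1)
    (hS' : ‖S'‖ ≤ 1) (hc : Commute S S') (h : S * S' = adjoint T) (x : H) :
    ‖opQ T hT (S x)‖ = ‖opQ T hT x‖ := by
  have c : Commute S (adjoint T) := h ▸ (Commute.refl S).mul_right hc
  have c' : Commute S' (adjoint T) := h ▸ hc.symm.mul_right (Commute.refl S')
  refine le_antisymm (norm_opQ_le_of_commute T hT hS c x) ?_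
  rw [← norm_opQ_adjoint, ← h, hc.eq]
  exact norm_opQ_le_of_commute T hT hS' c' (S x)

theorem exists_isoX_factorization (T : H →L[ℂ] H) (hT : ‖T‖ ≤ 1) {S₁ S₂ : H →L[ℂ] H}
    (h₁ : ‖S₁‖ ≤ 1) (h₂ : ‖S₂‖ ≤ 1) (hc : Commute S₁ S₂) (h : S₁ * S₂ = adjoint T) :
    ∃ A₁ A₂ : ranQ T hT →ₗᵢ[ℂ] ranQ T hT, A₁ * A₂ = isoX T hT ∧ A₂ * A₁ = isoX T hT ∧
      (∀ x, A₁ (opQr T hT x) = opQr T hT (S₁ x)) ∧ ∀ x, A₂ (opQr T hT x) = opQr T hT (S₂ x) := by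
  obtain ⟨A₁, hA₁⟩ := exists_isometry_of_denseRange (opQr T hT).toLinearMap
    ((opQr T hT).comp S₁).toLinearMap (opQr_denseRange T hT)
    (norm_opQ_eq_of_mul_eq T hT h₁ h₂ hc h)
  obtain ⟨A₂, hA₂⟩ := exists_isometry_of_denseRange (opQr T hT).toLinearMap
    ((opQr T hT).comp S₂).toLinearMap (opQr_denseRange T hT)
    (norm_opQ_eq_of_mul_eq T hT h₂ h₁ hc.symm (hc.symm.eq.trans h))
  have hA₁' : ∀ x, A₁ (opQr T hT x) = opQr T hT (S₁ x) := hA₁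
  have hA₂' : ∀ x, A₂ (opQr T hT x) = opQr T hT (S₂ x) := hA₂
  refine ⟨A₁, A₂, ?_, ?_, hA₁', hA₂'⟩
  · refine DFunLike.coe_injective ((opQr_denseRange T hT).equalizer (A₁ * A₂).continuous
      (isoX T hT).continuous (funext fun x => ?_))
    change A₁ (A₂ (opQr T hT x)) = isoX T hT (opQr T hT x)
    rw [hA₂', hA₁', isoX_opQr, ← h, opMul_apply]
  · refine DFunLike.coe_injective ((opQr_denseRange T hT).equalizer (A₂ * A₁).continuous
      (isoX T hT).continuous (funext fun x => ?_))
    change A₂ (A₁ (opQr T hT x)) = isoX T hT (opQr T hT x)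
    rw [hA₁', hA₂', isoX_opQr, ← h, hc.eq, opMul_apply]

variable {F : Type v} [NormedAddCommGroup F] [InnerProductSpace ℂ F]
variable {R : Type w} [NormedAddCommGroup R] [InnerProductSpace ℂ R]

theorem dilation_summable (T : H →L[ℂ] H) (hT : ‖T‖ ≤ 1) (Γ : defectSpace (adjoint T) →ₗᵢ[ℂ] F)
    (h : H) : Summable fun n => ‖Γ (defectLin (adjoint T) ((adjoint T ^ n) h))‖ ^ 2 :=
  (hasSum_norm_defectVec_sq T hT h).summable.congr fun _ => congrArg (· ^ 2) (Γ.norm_map _).symm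

/-- The isometry `h ↦ (∑ zⁿ Γ D_{T*} T*ⁿ h) ⊕ Q h`. -/
def dilationIso (T : H →L[ℂ] H) (hT : ‖T‖ ≤ 1) (Γ : defectSpace (adjoint T) →ₗᵢ[ℂ] F)
    (ι : ranQ T hT →ₗᵢ[ℂ] R) : H →ₗᵢ[ℂ] WithLp 2 (Hardy F × R) where
  toFun h := WithLp.toLp 2
    (hardyMk (fun n => Γ (defectLin (adjoint T) ((adjoint T ^ n) h)))
      (dilation_summable T hT Γ h), ι (opQr T hT h))
  map_add' x y := by
    refine prod_ext ?_ ?_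
    · ext n
      simp
    · simp
  map_smul' c x := by
    refine prod_ext ?_ ?_
    · ext n
      simp
    · simp
  norm_map' h := by
    refine (pow_left_inj₀ (norm_nonneg _) (norm_nonneg _) two_ne_zero).1 ?_
    rw [WithLp.prod_norm_sq_eq_of_L2]
    change ‖hardyMk (fun n => Γ (defectLin (adjoint T) ((adjoint T ^ n) h)))
        (dilation_summable T hT Γ h)‖ ^ 2 +
      ‖ι (opQr T hT h)‖ ^ 2 = ‖h‖ ^ 2
    rw [hardy_norm_sq, ι.norm_map]
    have := (hasSum_norm_defectVec_sq T hT h).tsum_eq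
    simp only [hardyMk_apply, Γ.norm_map]
    change ∑' n, ‖defectVec (adjoint T) ((adjoint T ^ n) h)‖ ^ 2 + ‖opQ T hT h‖ ^ 2 = _
    rw [this, sub_add_cancel]

@[simp] theorem dilationIso_fst (T : H →L[ℂ] H) (hT : ‖T‖ ≤ 1)
    (Γ : defectSpace (adjoint T) →ₗᵢ[ℂ] F) (ι : ranQ T hT →ₗᵢ[ℂ] R) (h : H) (n : ℕ) :
    (dilationIso T hT Γ ι h).fst n = Γ (defectVec (adjoint T) ((adjoint T ^ n) h)) := rfl

variable [CompleteSpace F] [CompleteSpace R]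

/-- The intertwining relation `(M_{A + zB} ⊕ W)* Π = Π S*` reduces to relations on the defect space
and on the range of `Q`. -/
theorem adjoint_mulAffine_dilationIso {T : H →L[ℂ] H} {hT : ‖T‖ ≤ 1}
    {Γ : defectSpace (adjoint T) →ₗᵢ[ℂ] F} {ι : ranQ T hT →ₗᵢ[ℂ] R} {A B : F →L[ℂ] F}
    {W : R →L[ℂ] R} {S : H →L[ℂ] H} (hc : Commute (adjoint S) (adjoint T))
    (h : ∀ x, adjoint A (Γ (defectVec (adjoint T) x)) +
      adjoint B (Γ (defectVec (adjoint T) (adjoint T x))) =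
        Γ (defectVec (adjoint T) (adjoint S x)))
    (hW : ∀ x, adjoint W (ι (opQr T hT x)) = ι (opQr T hT (adjoint S x))) (x : H) :
    adjoint (directSum (mulAffine A B) W) (dilationIso T hT Γ ι x) =
      dilationIso T hT Γ ι (adjoint S x) := by
  rw [adjoint_directSum]
  refine prod_ext ?_ ?_
  · ext n
    rw [directSum_fst, adjoint_mulAffine_apply, dilationIso_fst, dilationIso_fst, dilationIso_fst,
      pow_succ', opMul_apply, h, ← opMul_apply, (hc.pow_right n).eq, opMul_apply]
  · exact hW x

end Dilation

/-! ### Algebra of the model symbols and construction of the Andô tuple. -/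

section Models

variable {F : Type u} [NormedAddCommGroup F] [InnerProductSpace ℂ F] [CompleteSpace F]
variable {R : Type v} [NormedAddCommGroup R] [InnerProductSpace ℂ R] [CompleteSpace R]

theorem adjoint_mul' (A B : F →L[ℂ] F) : adjoint (A * B) = adjoint B * adjoint A :=
  star_mul A B

theorem isometry_directSum {A : F →L[ℂ] F} (hA : adjoint A * A = 1) (W : unitary (R →L[ℂ] R)) :
    Isometry (directSum A (W : R →L[ℂ] R)) := by
  rw [isometry_iff_adjoint_comp_self]
  change adjoint (directSum A (W : R →L[ℂ] R)) * directSum A (W : R →L[ℂ] R) = 1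
  rw [adjoint_directSum, directSum_mul, hA, ← directSum_one]
  exact congrArg _ (Unitary.star_mul_self_of_mem W.2)

/-- For `φ = u*p^⊥ + zu*p` and `ψ = pu + zp^⊥u` the four groups are the coefficient conditions for:
`φ` inner, `ψ` inner, `φψ = z`, `ψφ = z`. -/
theorem andoSymbol_relations {A : Type u} [Ring A] [StarRing A] {p u : A}
    (hp : IsStarProjection p) (hu : u ∈ unitary A) :
    (star (star u * (1 - p)) * (star u * (1 - p)) + star (star u * p) * (star u * p) = 1 ∧
      star (star u * (1 - p)) * (star u * p) = 0) ∧
    (star (p * u) * (p * u) + star ((1 - p) * u) * ((1 - p) * u) = 1 ∧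
      star (p * u) * ((1 - p) * u) = 0) ∧
    (star u * (1 - p) * (p * u) = 0 ∧ star u * p * ((1 - p) * u) = 0 ∧
      star u * (1 - p) * ((1 - p) * u) + star u * p * (p * u) = 1) ∧
    (p * u * (star u * (1 - p)) = 0 ∧ (1 - p) * u * (star u * p) = 0 ∧
      p * u * (star u * p) + (1 - p) * u * (star u * (1 - p)) = 1) := by
  have hpp : p * p = p := hp.1
  have hps : star p = p := hp.2
  have hpp' : ∀ x, p * (p * x) = p * x := fun x => by rw [← mul_assoc, hpp]
  have h₁ : star u * u = 1 := (Unitary.mem_iff.1 hu).1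
  have h₂ : u * star u = 1 := (Unitary.mem_iff.1 hu).2
  have h₂' : ∀ x, u * (star u * x) = x := fun x => by rw [← mul_assoc, h₂, one_mul]
  refine ⟨⟨?_, ?_⟩, ⟨?_, ?_⟩, ⟨?_, ?_, ?_⟩, ?_, ?_, ?_⟩ <;>
    simp [mul_assoc, sub_mul, mul_sub, hpp, hps, hpp', h₁, h₂, h₂']

theorem norm_le_one_of_adjoint_mul_self {A : F →L[ℂ] F} (hA : adjoint A * A = 1) : ‖A‖ ≤ 1 :=
  opNorm_le_bound _ zero_le_one fun x => by
    rw [one_mul]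
    exact ((norm_map_iff_adjoint_comp_self A).2 hA x).le

variable {E : Type w} [NormedAddCommGroup E] [InnerProductSpace ℂ E] [CompleteSpace E]

/-- The right-hand side of the hypothesis lies in `Ran Γ`, so applying `Γ*` loses nothing. This
carries the intertwining relation over to the compressed symbols. -/
theorem adjoint_compressTo_add_adjoint_compressTo (Γ : E →ₗᵢ[ℂ] F) {A B : F →L[ℂ] F} {x y z : E}
    (h : adjoint A (Γ x) + adjoint B (Γ y) = Γ z) :
    adjoint (compressTo Γ A) x + adjoint (compressTo Γ B) y = z := by
  rw [adjoint_compressTo, adjoint_compressTo]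
  change adjoint Γ.toContinuousLinearMap (adjoint A (Γ x)) +
    adjoint Γ.toContinuousLinearMap (adjoint B (Γ y)) = z
  rw [← map_add, h, adjoint_toContinuousLinearMap_apply]

/-- The operator `x ↦ A x ⊕ B x`. -/
def pairLin {D : Type*} [AddCommGroup D] [Module ℂ D] {X : Type*} [AddCommGroup X] [Module ℂ X]
    {Y : Type*} [AddCommGroup Y] [Module ℂ Y] (A : D →ₗ[ℂ] X) (B : D →ₗ[ℂ] Y) :
    D →ₗ[ℂ] WithLp 2 (X × Y) :=
  (WithLp.linearEquiv 2 ℂ (X × Y)).symm.toLinearMap ∘ₗ A.prod B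

theorem pairLin_apply {D : Type*} [AddCommGroup D] [Module ℂ D] {X : Type*} [AddCommGroup X]
    [Module ℂ X] {Y : Type*} [AddCommGroup Y] [Module ℂ Y] (A : D →ₗ[ℂ] X) (B : D →ₗ[ℂ] Y)
    (x : D) : pairLin A B x = WithLp.toLp 2 (A x, B x) := rfl

theorem norm_pairLin_sq {H : Type u} [NormedAddCommGroup H] [InnerProductSpace ℂ H]
    (A B : H →L[ℂ] H) (x : H) :
    ‖pairLin A.toLinearMap B.toLinearMap x‖ ^ 2 = ‖A x‖ ^ 2 + ‖B x‖ ^ 2 :=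
  WithLp.prod_norm_sq_eq_of_L2 _

variable {H : Type u} [NormedAddCommGroup H] [InnerProductSpace ℂ H] [CompleteSpace H]

/-- The Andô tuple of a commuting pair of contractions. -/
theorem exists_andoTuple {S₁ S₂ S : H →L[ℂ] H} (h₁ : ‖S₁‖ ≤ 1) (h₂ : ‖S₂‖ ≤ 1) (hS : ‖S‖ ≤ 1)
    (h₁₂ : S = S₁ * S₂) (h₂₁ : S = S₂ * S₁) :
    ∃ (F : Type u) (_ : NormedAddCommGroup F) (_ : InnerProductSpace ℂ F) (_ : CompleteSpace F)
      (P : F →L[ℂ] F) (U : unitary (F →L[ℂ] F)) (Γ : defectSpace S →ₗᵢ[ℂ] F),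
      IsStarProjection P ∧
      (∀ x, (1 - P) ((U : F →L[ℂ] F) (Γ (defectVec S x))) +
        P ((U : F →L[ℂ] F) (Γ (defectVec S (S x)))) = Γ (defectVec S (S₁ x))) ∧
      ∀ x, P (Γ (defectVec S x)) + (1 - P) (Γ (defectVec S (S x))) =
        (U : F →L[ℂ] F) (Γ (defectVec S (S₂ x))) := by
  have e₁₂ : ∀ x, S x = S₁ (S₂ x) := fun x => by rw [h₁₂, opMul_apply]
  have e₂₁ : ∀ x, S x = S₂ (S₁ x) := fun x => by rw [h₂₁, opMul_apply]
  let a := pairLin (defect S₁ * S₂).toLinearMap (defect S₂).toLinearMap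
  let b := pairLin (defect S₁).toLinearMap (defect S₂ * S₁).toLinearMap
  -- `(‖S₂x‖² - ‖S₁S₂x‖²) + (‖x‖² - ‖S₂x‖²)` collapses to `‖x‖² - ‖Sx‖²`. For `b` the same happens
  -- with `S = S₂S₁`.
  have ha : ∀ x, ‖a x‖ = ‖defectVec S x‖ := fun x => by
    refine (pow_left_inj₀ (norm_nonneg _) (norm_nonneg _) two_ne_zero).1 ?_
    rw [norm_pairLin_sq, norm_defectVec_sq S hS, opMul_apply, norm_defect_sq S₁ h₁,
      norm_defect_sq S₂ h₂, e₁₂]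
    ring
  have hb : ∀ x, ‖b x‖ = ‖a x‖ := fun x => by
    rw [ha]
    refine (pow_left_inj₀ (norm_nonneg _) (norm_nonneg _) two_ne_zero).1 ?_
    rw [norm_pairLin_sq, norm_defectVec_sq S hS, opMul_apply, norm_defect_sq S₁ h₁,
      norm_defect_sq S₂ h₂, e₂₁]
    ring
  obtain ⟨U, hU⟩ := exists_unitary_extension a b hb
  obtain ⟨Γ, hΓ⟩ := exists_isometry_of_denseRange (defectLin S)
    (pairLin a (0 : H →ₗ[ℂ] WithLp 2 (H × H))) (defectVec_denseRange S) (fun x => by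
      rw [pairLin_apply]
      exact (WithLp.norm_toLp_fst 2 _ _ (a x)).trans (ha x))
  have hΓ' : ∀ x, Γ (defectVec S x) = WithLp.toLp 2 (a x, 0) := hΓ
  -- `P` keeps only the `D_{S₁}` coordinate of the first copy of `H ⊕ H`. The second copy serves
  -- only to make `U` unitary, and all vectors in the two relations vanish there.
  refine ⟨_, _, _, inferInstance, directSum (directSum 1 0) 0, U, Γ,
    isStarProjection_directSum (isStarProjection_directSum (.one _) (.zero _)) (.zero _),
    fun x => ?_, fun x => ?_⟩
  · rw [hΓ', hΓ', hΓ', hU, hU]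
    refine prod_ext (prod_ext ?_ ?_) ?_
    · change (defect S₁ x - defect S₁ x) + defect S₁ (S x) = defect S₁ (S₂ (S₁ x))
      rw [sub_self, zero_add, e₂₁]
    · change (defect S₂ (S₁ x) - 0) + 0 = defect S₂ (S₁ x)
      rw [sub_zero, add_zero]
    · change ((0 : WithLp 2 (H × H)) - 0) + 0 = 0
      rw [sub_zero, add_zero]
  · rw [hΓ', hΓ', hΓ', hU]
    refine prod_ext (prod_ext ?_ ?_) ?_
    · change defect S₁ (S₂ x) + (defect S₁ (S₂ (S x)) - defect S₁ (S₂ (S x))) = defect S₁ (S₂ x)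
      rw [sub_self, add_zero]
    · change 0 + (defect S₂ (S x) - 0) = defect S₂ (S₁ (S₂ x))
      rw [sub_zero, zero_add, e₁₂]
    · change (0 : WithLp 2 (H × H)) + (0 - 0) = 0
      rw [sub_zero, add_zero]

instance completeSpace_range {K : Type v} [NormedAddCommGroup K] [InnerProductSpace ℂ K]
    (J : H →ₗᵢ[ℂ] K) : CompleteSpace (LinearMap.range J.toLinearMap) :=
  IsComplete.completeSpace_coe (J.isometry.isUniformInducing.isComplete_range)

end Models

/-! ### From a commuting factorization to the explicit models. -/

section Models

variable {R : Type v} [NormedAddCommGroup R] [InnerProductSpace ℂ R] [CompleteSpace R]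
variable {H : Type u} [NormedAddCommGroup H] [InnerProductSpace ℂ H] [CompleteSpace H]

/-- `M_z` has the affine symbol `0 + z·1`, and with `Γ` the identity the embedding is the usual
Douglas one. -/
theorem adjoint_douglasV_dilationIso {T : H →L[ℂ] H} {hT : ‖T‖ ≤ 1} {ι : ranQ T hT →ₗᵢ[ℂ] R}
    {W : unitary (R →L[ℂ] R)}
    (hW : ∀ x, adjoint (W : R →L[ℂ] R) (ι (opQr T hT x)) = ι (opQr T hT (adjoint T x))) (x : H) :
    adjoint (douglasV T W) (dilationIso T hT LinearIsometry.id ι x) =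
      dilationIso T hT LinearIsometry.id ι (adjoint T x) := by
  have hV : douglasV T W = directSum (mulAffine 0 1) (W : R →L[ℂ] R) :=
    congrArg (directSum · (W : R →L[ℂ] R)) hardyShift_eq_mulAffine
  refine (congrArg (fun V => adjoint V (dilationIso T hT LinearIsometry.id ι x)) hV).trans
    (adjoint_mulAffine_dilationIso (Commute.refl _) (fun y => ?_) hW x)
  rw [map_zero, zero_apply, zero_add, adjoint_one_apply]

theorem douglasCompression_of_intertwine {T₁ T₂ T : H →L[ℂ] H}
    (h : CommutingFactorization T₁ T₂ T) {W : unitary (R →L[ℂ] R)}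
    {D₁ D₂ : WithLp 2 (Hardy (defectSpace (adjoint T)) × R) →L[ℂ]
      WithLp 2 (Hardy (defectSpace (adjoint T)) × R)} (hD₁ : ‖D₁‖ ≤ 1) (hD₂ : ‖D₂‖ ≤ 1)
    {J : H →ₗᵢ[ℂ] WithLp 2 (Hardy (defectSpace (adjoint T)) × R)}
    (h₁ : ∀ x, adjoint D₁ (J x) = J (adjoint T₁ x)) (h₂ : ∀ x, adjoint D₂ (J x) = J (adjoint T₂ x))
    (hV : ∀ x, adjoint (douglasV T W) (J x) = J (adjoint T x)) :
    DouglasCompression T₁ T₂ T W D₁ D₂ := by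
  have h₁₂ : ∀ x, adjoint (D₁ * D₂) (J x) = J (adjoint T x) := fun x =>
    (adjoint_mul_intertwine h₁ h₂ x).trans (congrArg (fun S => J (adjoint S x)) h.2.symm)
  have h₂₁ : ∀ x, adjoint (D₂ * D₁) (J x) = J (adjoint T x) := fun x =>
    (adjoint_mul_intertwine h₂ h₁ x).trans
      (congrArg (fun S => J (adjoint S x)) (h.1.symm.eq.trans h.2.symm))
  exact ⟨hD₁, hD₂, _, completeSpace_range J, coinvariant_range h₁, coinvariant_range h₂,
    coinvariant_range hV, unitarilyEquivalent_compression_range h₁ h₂ hV,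
    compression_range_congr hV h₁₂, compression_range_congr hV h₂₁⟩

theorem explicitModels {T₁ T₂ T : H →L[ℂ] H} (hT₁ : ‖T₁‖ ≤ 1) (hT₂ : ‖T₂‖ ≤ 1) (hT : ‖T‖ ≤ 1)
    {ι : ranQ T hT →ₗᵢ[ℂ] R} {W : unitary (R →L[ℂ] R)}
    (hW : IsMinimalUnitaryExtension (isoX T hT) ι (star W))
    (h : CommutingFactorization T₁ T₂ T) : ExplicitModels T₁ T₂ T hT ι W := by
  obtain ⟨hc, hfac⟩ := h
  have hS : ∀ {S : H →L[ℂ] H}, ‖S‖ ≤ 1 → ‖adjoint S‖ ≤ 1 := fun hS => by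
    rwa [LinearIsometryEquiv.norm_map]
  have hcS : Commute (adjoint T₁) (adjoint T₂) := hc.star_star
  have h₁₂ : adjoint T = adjoint T₁ * adjoint T₂ := by rw [hfac, hc.eq, adjoint_mul']
  have h₂₁ : adjoint T = adjoint T₂ * adjoint T₁ := by rw [hfac, adjoint_mul']
  have c₁ : Commute (adjoint T₁) (adjoint T) := h₁₂ ▸ (Commute.refl _).mul_right hcS
  have c₂ : Commute (adjoint T₂) (adjoint T) := h₁₂ ▸ hcS.symm.mul_right (Commute.refl _)
  obtain ⟨A₁, A₂, hA₁₂, hA₂₁, hA₁, hA₂⟩ :=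
    exists_isoX_factorization T hT (hS hT₁) (hS hT₂) hcS h₁₂.symm
  obtain ⟨Y₁, Y₂, hYc, hY, hY₁, hY₂⟩ := hW.exists_factorization A₁ A₂ hA₁₂ hA₂₁
  obtain ⟨F, _, _, _, P, U, Γ, hP, hPU₁, hPU₂⟩ :=
    exists_andoTuple (hS hT₁) (hS hT₂) (hS hT) h₁₂ h₂₁
  obtain ⟨⟨r₁, r₂⟩, ⟨r₃, r₄⟩, ⟨r₅, r₆, r₇⟩, r₈, r₉, r₁₀⟩ := andoSymbol_relations hP U.2
  have i₁ := adjoint_mul_mulAffine _ _ r₁ r₂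
  have i₂ := adjoint_mul_mulAffine _ _ r₃ r₄
  simp only [star_eq_adjoint] at i₁
  have hPs : adjoint P = P := hP.2
  have hQs : adjoint (1 - P) = 1 - P := hP.one_sub.2
  have hadjU : ∀ x, adjoint (U : F →L[ℂ] F) ((U : F →L[ℂ] F) x) = x := fun x =>
    DFunLike.congr_fun (Unitary.star_mul_self_of_mem U.2) x
  have s₁ : ∀ x, adjoint (adjoint (U : F →L[ℂ] F) * (1 - P)) (Γ (defectVec (adjoint T) x)) +
      adjoint (adjoint (U : F →L[ℂ] F) * P) (Γ (defectVec (adjoint T) (adjoint T x))) =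
      Γ (defectVec (adjoint T) (adjoint T₁ x)) := fun x => by
    rw [adjoint_mul', adjoint_mul', hPs, hQs, adjoint_adjoint]
    exact hPU₁ x
  have s₂ : ∀ x, adjoint (P * (U : F →L[ℂ] F)) (Γ (defectVec (adjoint T) x)) +
      adjoint ((1 - P) * (U : F →L[ℂ] F)) (Γ (defectVec (adjoint T) (adjoint T x))) =
      Γ (defectVec (adjoint T) (adjoint T₂ x)) := fun x => by
    rw [adjoint_mul', adjoint_mul', hPs, hQs, opMul_apply, opMul_apply, ← map_add, hPU₂, hadjU]
  have w₁ : ∀ x, adjoint ((star Y₁ : unitary (R →L[ℂ] R)) : R →L[ℂ] R) (ι (opQr T hT x)) =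
      ι (opQr T hT (adjoint T₁ x)) := fun x => by
    rw [← star_eq_adjoint, Unitary.coe_star, star_star, hY₁, hA₁]
  have w₂ : ∀ x, adjoint ((star Y₂ : unitary (R →L[ℂ] R)) : R →L[ℂ] R) (ι (opQr T hT x)) =
      ι (opQr T hT (adjoint T₂ x)) := fun x => by
    rw [← star_eq_adjoint, Unitary.coe_star, star_star, hY₂, hA₂]
  have w : ∀ x, adjoint (W : R →L[ℂ] R) (ι (opQr T hT x)) = ι (opQr T hT (adjoint T x)) :=
    fun x => by
      rw [← isoX_opQr]
      exact hW.extends_isometry _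
  -- `W*` is what extends `X*`, so the lifted factors `Y₁`, `Y₂` are the adjoints of the required
  -- `W₁`, `W₂`.
  refine ⟨F, _, _, _, P, U, star Y₁, star Y₂, Γ, hP, hYc.star_star, ?_,
    ⟨dilationIso T hT Γ ι, completeSpace_range _, fun x => ⟨fun n => rfl, rfl⟩, ?_⟩, ?_⟩
  · rw [← star_mul, ← hYc.eq, hY, star_star]
  · have t₁ := adjoint_mulAffine_dilationIso c₁ s₁ w₁
    have t₂ := adjoint_mulAffine_dilationIso c₂ s₂ w₂
    have t₁₂ := adjoint_mul_intertwine t₁ t₂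
    refine ⟨fun x => ⟨t₁ x, t₂ x, t₁₂ x⟩, isometry_directSum i₁ _, isometry_directSum i₂ _, ?_,
      coinvariant_range t₁, coinvariant_range t₂, ?_⟩
    · rw [commute_iff_eq, andoV₁, andoV₂, directSum_mul, directSum_mul]
      -- In either order the product of the two multiplication operators is `M_z`.
      exact congrArg₂ directSum
        ((mulAffine_mul _ _ _ _ r₅ r₆ r₇).trans (mulAffine_mul _ _ _ _ r₈ r₉ r₁₀).symm)
        (congrArg Subtype.val hYc.star_star.eq)
    · rw [← hfac] at t₁₂
      exact unitarilyEquivalent_compression_range t₁ t₂ t₁₂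
  -- `G₁* = Γ*U*P^⊥Γ` and `G₂* = Γ*PUΓ`, so `Φ = Γ*φΓ` and `Ψ = Γ*ψΓ` for the symbols `φ`, `ψ` of
  -- the Andô model.
  · have e₁ : adjoint (compressTo Γ ((1 - P) * (U : F →L[ℂ] F))) =
        compressTo Γ (adjoint (U : F →L[ℂ] F) * (1 - P)) := by
      rw [adjoint_compressTo, adjoint_mul', hQs]
    have e₂ : adjoint (compressTo Γ (adjoint (U : F →L[ℂ] F) * P)) =
        compressTo Γ (P * (U : F →L[ℂ] F)) := by
      rw [adjoint_compressTo, adjoint_mul', hPs, adjoint_adjoint]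
    rw [douglasD, douglasD, e₁, e₂]
    have nW : ∀ V : unitary (R →L[ℂ] R), ‖(V : R →L[ℂ] R)‖ ≤ 1 := fun V =>
      norm_le_one_of_adjoint_mul_self (Unitary.star_mul_self_of_mem V.2)
    have n₁ := norm_mulAffine_compressTo_le Γ _ _ (norm_le_one_of_adjoint_mul_self i₁)
    have n₂ := norm_mulAffine_compressTo_le Γ _ _ (norm_le_one_of_adjoint_mul_self i₂)
    have t₁ := adjoint_mulAffine_dilationIso (Γ := LinearIsometry.id)
      (A := compressTo Γ (adjoint (U : F →L[ℂ] F) * (1 - P)))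
      (B := compressTo Γ (adjoint (U : F →L[ℂ] F) * P)) c₁
      (fun x => adjoint_compressTo_add_adjoint_compressTo Γ (s₁ x)) w₁
    have t₂ := adjoint_mulAffine_dilationIso (Γ := LinearIsometry.id)
      (A := compressTo Γ (P * (U : F →L[ℂ] F)))
      (B := compressTo Γ ((1 - P) * (U : F →L[ℂ] F))) c₂
      (fun x => adjoint_compressTo_add_adjoint_compressTo Γ (s₂ x)) w₂
    exact douglasCompression_of_intertwine ⟨hc, hfac⟩
      (norm_directSum_le_one n₁ (nW _)) (norm_directSum_le_one n₂ (nW _)) t₁ t₂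
      (adjoint_douglasV_dilationIso w)

theorem ExplicitModels.andoModel {R : Type u} [NormedAddCommGroup R] [InnerProductSpace ℂ R]
    [CompleteSpace R] {T₁ T₂ T : H →L[ℂ] H} {hT : ‖T‖ ≤ 1} {ι : ranQ T hT →ₗᵢ[ℂ] R}
    {W : unitary (R →L[ℂ] R)} (h : ExplicitModels T₁ T₂ T hT ι W) : AndoModel T₁ T₂ T := by
  obtain ⟨F, _, _, _, P, U, W₁, W₂, Γ, hP, hc, -, ⟨Pi, hcomp, -, -, hPi⟩, -⟩ := h
  exact ⟨F, _, _, ‹_›, R, _, _, ‹_›, P, U, W₁, W₂, hP, hc, _, hcomp, hPi⟩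

theorem ExplicitModels.douglasModel {T₁ T₂ T : H →L[ℂ] H} {hT : ‖T‖ ≤ 1}
    {ι : ranQ T hT →ₗᵢ[ℂ] R} {W : unitary (R →L[ℂ] R)} (h : ExplicitModels T₁ T₂ T hT ι W) :
    DouglasModel T₁ T₂ T W := by
  obtain ⟨F, _, _, _, P, U, W₁, W₂, Γ, -, -, -, -, hD⟩ := h
  exact ⟨_, _, hD⟩

end Models

end AndoDouglas

end

/-! ### The equivalences and the supplement. -/

theorem theorem1p3 {H : Type*} [NormedAddCommGroup H] [InnerProductSpace ℂ H] [CompleteSpace H]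
    (T₁ T₂ T : H →L[ℂ] H) (hT₁ : ‖T₁‖ ≤ 1) (hT₂ : ‖T₂‖ ≤ 1) (hT : ‖T‖ ≤ 1)
    {R : Type*} [NormedAddCommGroup R] [InnerProductSpace ℂ R] [CompleteSpace R]
    (ι : AndoDouglas.ranQ T hT →ₗᵢ[ℂ] R) (W : unitary (R →L[ℂ] R))
    (hW : AndoDouglas.IsMinimalUnitaryExtension (AndoDouglas.isoX T hT) ι (star W)) :
    [AndoDouglas.CommutingFactorization T₁ T₂ T,
      AndoDouglas.AndoModel T₁ T₂ T,
      AndoDouglas.DouglasModel T₁ T₂ T W].TFAE ∧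
    (AndoDouglas.CommutingFactorization T₁ T₂ T →
      AndoDouglas.ExplicitModels T₁ T₂ T hT ι W) := by
  have hD : AndoDouglas.CommutingFactorization T₁ T₂ T →
      AndoDouglas.ExplicitModels T₁ T₂ T hT ι W :=
    AndoDouglas.explicitModels hT₁ hT₂ hT hW
  have hA : AndoDouglas.CommutingFactorization T₁ T₂ T → AndoDouglas.AndoModel T₁ T₂ T := by
    intro h
    -- (A') asks for a residual space in the universe of `H`, while the given `R` may live in
    -- another one. Hence a fresh minimal unitary extension is used here.
    obtain ⟨R', _, _, _, ι', Y, hY⟩ :=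
      AndoDouglas.exists_minimalUnitaryExtension (AndoDouglas.isoX T hT)
    rw [← star_star Y] at hY
    exact (AndoDouglas.explicitModels hT₁ hT₂ hT hY h).andoModel
  refine ⟨?_, hD⟩
  tfae_have 1 → 2 := hA
  tfae_have 2 → 1 := AndoDouglas.commutingFactorization_of_andoModel
  tfae_have 1 → 3 := fun h => (hD h).douglasModel
  tfae_have 3 → 1 := AndoDouglas.commutingFactorization_of_douglasModel
  tfae_finish
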